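/- **Setting.** Fix positive integers $a$ and $d$. A *rooted directed tree* is a directed graph $(V,\mathcal E)$ with a vertex $\mathsf{root}$ that has no parent, such that every other vertex has exactly one parent and is reachable from $\mathsf{root}$ by a directed path. $\mathrm{Chi}(v)$ is the set of children of $v$, the depth $\mathsf d_v\in\mathbb N$ is the number of edges from $\mathsf{root}$ to $v$, and $v$ is *branching* if it has at least two children. All trees below are countably infinite, leafless (every vertex has a child), locally finite (every vertex has finitely many children) and of *finite branching index* (the depths of the branching vertices are bounded). The *directed Cartesian product* $\mathscr T=(V,\mathcal E)$ of $\mathscr T_j=(V_j,\mathcal E_j)$, $1\le j\le d$, has $V=V_1\times\cdots\times V_d$, and $(v,w)\in\mathcal E$ iff for some $k$ one has $(v_k,w_k)\in\mathcal E_k$ and $v_j=w_j$ for $j\ne k$. Two directed graphs are isomorphic if there is a bijection of the vertices that preserves directed edges in both directions. For $v\in V$ put $\mathsf d_v=(\mathsf d_{v_1},\dots,\mathsf d_{v_d})\in\mathbb N^d$ and $|\mathsf d_v|=\sum_j\mathsf d_{v_j}$; $\mathrm{Chi}_j(v)$ is the set of the vertices obtained from $v$ by replacing $v_j$ by one of its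 children, and $\mathrm{par}_j(w)$ is obtained from $w$ (with $w_j\ne\mathsf{root}_j$) by replacing $w_j$ by its parent. Let $\mathfrak c_a(t)=\frac{t+d}{t+a}$ and, for $w\in\mathrm{Chi}_j(v)$, $$\lambda_j(w)=\sqrt{\frac{\mathfrak c_a(|\mathsf d_v|)}{\mathrm{card}\,\mathrm{Chi}_j(v)}}\sqrt{\frac{\mathsf d_{v_j}+1}{|\mathsf d_v|+d}} .$$ Define bounded operators $S_1,\dots,S_d$ on $l^2(V)$ by $(S_jf)(w)=\lambda_j(w)f(\mathrm{par}_j(w))$ if $w_j\neq\mathsf{root}_j$ and $(S_jf)(w)=0$ otherwise, and put $E=\bigcap_{j}\ker S_j^*$. For $F\subseteq\{1,\dots,d\}$ let $\Phi_F=\{v\in V: v_j\ne\mathsf{root}_j\Leftrightarrow j\in F\}$; for $u\in\Phi_F$ let $\mathsf{sib}_F(u)$ be the set of $v\in\Phi_F$ such that $v_j$ and $u_j$ have the same parent for all $j\in F$; let $\Omega_F$ contain exactly one element of each of the classes $\mathsf{sib}_F(u)$, $u\in\Phi_F$. Let $\mathcal L_{u,F}\subseteq E$ be the space of the $f\in l^2(V)$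 supported on $\mathsf{sib}_F(u)$ with $\sum_w f(w)\lambda_j(w)=0$ for all $j\in F$ and $v\in\mathsf{sib}_F(u)$, where $w$ runs over the vertices obtained from $v$ by replacing $v_j$ by any vertex with the same parent as $u_j$. Let $P_{\mathcal L_{u,F}}\in B(E)$ be the orthogonal projection onto $\mathcal L_{u,F}$. The *Drury–Arveson-type Hilbert module* $\mathscr H_{\mathfrak c_a}(\mathscr T)$ is the reproducing kernel Hilbert space of $E$-valued functions on the open unit ball $\mathbb B^d$ of $\mathbb C^d$ with the kernel $$\kappa(z,w)=\sum_{F\subseteq\{1,\dots,d\}}\ \sum_{u\in\Omega_F}\Big(\sum_{\alpha\in\mathbb N^d}\frac{\mathsf d_u!}{(\mathsf d_u+\alpha)!}\prod_{j=0}^{|\alpha|-1}(|\mathsf d_u|+a+j)\;z^\alpha\overline w^\alpha\Big)P_{\mathcal L_{u,F}},$$ together with the bounded operators $\mathscr M_{z_1},\dots,\mathscr M_{z_d}$ of multiplication by the coordinate functions. Two such modules are *isomorphic* if there is a unitary map $U$ between them such that $U\mathscr M_{z_k}=\mathscr M_{z_k}U$ for $k=1,\dots,d$. **Corollary.** Let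 $a,d$ be positive integers. 1. There are infinitely many mutually non-isomorphic Drury–Arveson-type Hilbert modules: there is a sequence $\mathscr T^{(0)},\mathscr T^{(1)},\dots$ of directed Cartesian products of $d$ trees as above such that $\mathscr H_{\mathfrak c_a}(\mathscr T^{(m)})$ and $\mathscr H_{\mathfrak c_a}(\mathscr T^{(n)})$ are not isomorphic for $m\ne n$. 2. For every positive integer $k$ there are $k$ mutually non-isomorphic (as directed graphs) directed Cartesian products $\mathscr T^{(1)},\dots,\mathscr T^{(k)}$ of $d$ trees as above such that the Hilbert modules $\mathscr H_{\mathfrak c_a}(\mathscr T^{(1)}),\dots,\mathscr H_{\mathfrak c_a}(\mathscr T^{(k)})$ are all isomorphic. -/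

import Mathlib

noncomputable section

namespace DruryArveson

/-- A rooted directed tree: a directed graph with a root which has no parent, in which every other
vertex has exactly one parent and every vertex can be reached from the root by a directed path.
(These properties exclude loops and circuits.) -/
structure RootedDirectedTree where
  /-- the vertices -/
  V : Type
  /-- `Adj u v` means that `(u, v)` is a directed edge -/
  Adj : V → V → Prop
  /-- the root -/
  root : V
  not_adj_root : ∀ u, ¬ Adj u root
  existsUnique_parent : ∀ v, v ≠ root → ∃! u, Adj u v
  reachable : ∀ v, Relation.ReflTransGen Adj root v

namespace RootedDirectedTree

variable (T : RootedDirectedTree)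

/-- The set `Chi(v)` of children of a vertex. -/
def children (v : T.V) : Set T.V := {w | T.Adj v w}

open scoped Classical in
/-- The parent of a vertex (the root, which has no parent, is sent to itself). -/
def parent (v : T.V) : T.V := if h : ∃ u, T.Adj u v then h.choose else v

/-- The `n`-th generation: the vertices `n` steps below the root. -/
def generation : ℕ → Set T.V
  | 0 => {T.root}
  | n + 1 => {w | ∃ v ∈ generation n, T.Adj v w}

/-- The depth of a vertex: the (only) `n` such that the vertex belongs to the `n`-th generation. -/
def depth (v : T.V) : ℕ := sInf {n | v ∈ T.generation n}

/-- The branching vertices: those with at least two children. -/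
def branching : Set T.V := {v | (T.children v).Nontrivial}

/-- The branching index: `1 + sup {depth w : w branching}`, or `0` if no vertex is branching. -/
def branchingIndex : ℕ∞ := ⨆ w ∈ T.branching, ((T.depth w : ℕ∞) + 1)

end RootedDirectedTree

/-- The data of a directed Cartesian product of `d` rooted directed trees, each of them countably
infinite, leafless, locally finite and of finite branching index. -/
structure TreeProduct (d : ℕ) where
  /-- the factors -/
  tree : Fin d → RootedDirectedTree
  countable : ∀ j, Countable (tree j).V
  infinite : ∀ j, Infinite (tree j).V
  leafless : ∀ j v, ((tree j).children v).Nonempty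
  locallyFinite : ∀ j v, ((tree j).children v).Finite
  finite_branchingIndex : ∀ j, (tree j).branchingIndex < ⊤

namespace TreeProduct

variable {d : ℕ} (T : TreeProduct d)

/-- The vertices of the directed Cartesian product. -/
abbrev Vert : Type := ∀ j, (T.tree j).V

/-- The edges of the directed Cartesian product. -/
def Adj (v w : T.Vert) : Prop :=
  ∃ k, (∀ j, j ≠ k → v j = w j) ∧ (T.tree k).Adj (v k) (w k)

/-- Isomorphism of directed graphs: a bijection between the vertices that preserves edges (in both
directions). -/
def GraphIso (T' : TreeProduct d) : Prop := Nonempty (T.Adj ≃r T'.Adj)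

/-- The finite set of children of a vertex of the `j`-th factor. -/
def childFinset (j : Fin d) (x : (T.tree j).V) : Finset (T.tree j).V :=
  (T.locallyFinite j x).toFinset

/-- The depth of a vertex of the product, a multiindex. -/
def depth (v : T.Vert) : Fin d → ℕ := fun j => (T.tree j).depth (v j)

/-- `par_j(v)`: replace the `j`-th coordinate by its parent. -/
def par (j : Fin d) (v : T.Vert) : T.Vert := Function.update v j ((T.tree j).parent (v j))

/-- The sequence `c_a(t) = (t + d) / (t + a)`. -/
def cSeq (d a t : ℕ) : ℝ := ((t : ℝ) + d) / (t + a)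

/-- The weights of the Drury-Arveson-type multishift. For `w ∈ Chi_j(v)`, that is `v = par_j(w)`
with `w j ≠ root`,
`λ_j(w) = √(c_a(|d_v|) / card Chi_j(v)) * √((d_{v_j} + 1) / (|d_v| + d))`. -/
def weight (a : ℕ) (j : Fin d) (w : T.Vert) : ℝ :=
  let v := T.par j w
  √(cSeq d a (∑ i, T.depth v i) / (T.childFinset j (v j)).card) *
    √(((T.depth v j : ℝ) + 1) / ((∑ i, T.depth v i : ℕ) + d))

/-- The Hilbert space `l²(V)`. -/
abbrev L2 : Type := lp (fun _ : T.Vert => ℂ) 2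

open scoped Classical in
/-- The transformation `Λ_j` of the functions on `V` that underlies the multishift. -/
def shiftFun (a : ℕ) (j : Fin d) (f : T.Vert → ℂ) : T.Vert → ℂ := fun w =>
  if w j ≠ (T.tree j).root then (T.weight a j w : ℂ) * f (T.par j w) else 0

lemma adj_parent (S : RootedDirectedTree) (x : S.V) (hx : x ≠ S.root) : S.Adj (S.parent x) x := by
  have h : ∃ u, S.Adj u x := (S.existsUnique_parent x hx).exists
  rw [RootedDirectedTree.parent, dif_pos h]
  exact h.choose_spec

lemma cSeq_le (d a t : ℕ) : cSeq d a t ≤ d + 1 := by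
  unfold cSeq
  rcases Nat.eq_zero_or_pos (t + a) with h | h
  · have h' : (t : ℝ) + a = 0 := by exact_mod_cast h
    rw [h', div_zero]; positivity
  · have h' : (1 : ℝ) ≤ (t : ℝ) + a := by exact_mod_cast h
    rw [div_le_iff₀ (by linarith)]
    have ha : (0 : ℝ) ≤ a := by positivity
    nlinarith [mul_nonneg (Nat.cast_nonneg (α := ℝ) d) (sub_nonneg.2 h')]

/-- The weights of the children of `v` in the direction `j` are uniformly square summable. -/
lemma sum_weight_sq_le (a : ℕ) (j : Fin d) (v : T.Vert) (s : Finset T.Vert)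
    (hs : ∀ w ∈ s, w j ≠ (T.tree j).root ∧ T.par j w = v) :
    ∑ w ∈ s, (T.weight a j w) ^ 2 ≤ d + 1 := by
  classical
  set n := (T.childFinset j (v j)).card with hn
  have hcard : s.card ≤ n := by
    refine Finset.card_le_card_of_injOn (fun w => w j) ?_ ?_
    · intro w hw
      obtain ⟨h1, h2⟩ := hs w hw
      have h3 := adj_parent (T.tree j) (w j) h1
      have h4 : v j = (T.tree j).parent (w j) := by rw [← h2]; simp [par]
      simp only [childFinset, Set.Finite.coe_toFinset, RootedDirectedTree.children,
        Set.mem_ofPred_eq, h4]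
      exact h3
    · intro w hw w' hw' h
      obtain ⟨-, h2⟩ := hs w hw
      obtain ⟨-, h2'⟩ := hs w' hw'
      funext i
      by_cases hi : i = j
      · subst hi; exact h
      · have e : T.par j w i = T.par j w' i := by rw [h2, h2']
        simpa [par, hi] using e
  set q : ℝ := ((T.depth v j : ℝ) + 1) / ((∑ i, T.depth v i : ℕ) + d) with hq
  have hc0 : 0 ≤ cSeq d a (∑ i, T.depth v i) := by unfold cSeq; positivity
  have hq0 : 0 ≤ q := by rw [hq]; positivity
  have hd1 : (1 : ℝ) ≤ d := by exact_mod_cast Fin.pos j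
  have hq1 : q ≤ 1 := by
    rw [hq]
    apply div_le_one_of_le₀ _ (by positivity)
    have : T.depth v j ≤ ∑ i, T.depth v i :=
      Finset.single_le_sum (f := T.depth v) (fun _ _ => Nat.zero_le _) (Finset.mem_univ j)
    have : (T.depth v j : ℝ) ≤ (∑ i, T.depth v i : ℕ) := by exact_mod_cast this
    linarith
  have hw : ∀ w ∈ s, (T.weight a j w) ^ 2 = cSeq d a (∑ i, T.depth v i) / n * q := by
    intro w hw
    obtain ⟨-, h2⟩ := hs w hw
    simp only [weight, h2]
    rw [mul_pow, Real.sq_sqrt (by positivity), Real.sq_sqrt (by positivity)]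
  rw [Finset.sum_congr rfl hw, Finset.sum_const, nsmul_eq_mul]
  have hc1 := cSeq_le d a (∑ i, T.depth v i)
  have hcn : (s.card : ℝ) * (cSeq d a (∑ i, T.depth v i) / n) ≤ d + 1 := by
    rcases Nat.eq_zero_or_pos n with h0 | h0
    · rw [h0]; simp; positivity
    · have h0' : (0 : ℝ) < n := by exact_mod_cast h0
      have hcard' : (s.card : ℝ) ≤ n := by exact_mod_cast hcard
      calc (s.card : ℝ) * (cSeq d a (∑ i, T.depth v i) / n)
          ≤ n * (cSeq d a (∑ i, T.depth v i) / n) := by gcongr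
        _ = cSeq d a (∑ i, T.depth v i) := by field_simp
        _ ≤ d + 1 := hc1
  calc (s.card : ℝ) * (cSeq d a (∑ i, T.depth v i) / n * q)
      = ((s.card : ℝ) * (cSeq d a (∑ i, T.depth v i) / n)) * q := by ring
    _ ≤ (d + 1) * 1 := by gcongr
    _ = d + 1 := by ring

lemma sum_norm_shiftFun_sq_le (a : ℕ) (j : Fin d) (f : T.L2) (s : Finset T.Vert) :
    ∑ w ∈ s, ‖T.shiftFun a j f w‖ ^ 2 ≤ (d + 1) * ‖f‖ ^ 2 := by
  classical
  have key : ∀ t : Finset T.Vert, ∑ v ∈ t, ‖f v‖ ^ 2 ≤ ‖f‖ ^ 2 := by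
    intro t
    have := lp.sum_rpow_le_norm_rpow (p := 2) (by norm_num) f t
    simpa using this
  have h1 : ∑ w ∈ s, ‖T.shiftFun a j f w‖ ^ 2 =
      ∑ w ∈ s with w j ≠ (T.tree j).root, (T.weight a j w) ^ 2 * ‖f (T.par j w)‖ ^ 2 := by
    rw [Finset.sum_filter]
    refine Finset.sum_congr rfl fun w _ => ?_
    unfold shiftFun
    split_ifs
    · rw [norm_mul, mul_pow, Complex.norm_real, Real.norm_eq_abs, sq_abs]
    · simp
  rw [h1, ← Finset.sum_fiberwise_of_maps_to (t := s.image (T.par j)) (g := T.par j)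
    (fun w hw => Finset.mem_image_of_mem _ (Finset.mem_filter.1 hw).1)]
  calc _ ≤ ∑ v ∈ s.image (T.par j), ((d : ℝ) + 1) * ‖f v‖ ^ 2 := by
        refine Finset.sum_le_sum fun v _ => ?_
        rw [Finset.sum_congr rfl (g := fun w => (T.weight a j w) ^ 2 * ‖f v‖ ^ 2)
          (fun w hw => by rw [(Finset.mem_filter.1 hw).2]), ← Finset.sum_mul]
        gcongr
        refine T.sum_weight_sq_le a j v _ fun w hw => ?_
        simp only [Finset.mem_filter] at hw
        exact ⟨hw.1.2, hw.2⟩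
    _ = (d + 1) * ∑ v ∈ s.image (T.par j), ‖f v‖ ^ 2 := by rw [Finset.mul_sum]
    _ ≤ _ := by gcongr; exact key _

lemma memℓp_shiftFun (a : ℕ) (j : Fin d) (f : T.L2) : Memℓp (T.shiftFun a j f) 2 := by
  refine memℓp_gen' (C := (d + 1) * ‖f‖ ^ 2) fun s => ?_
  simpa using T.sum_norm_shiftFun_sq_le a j f s

/-- The `j`-th operator `S_j` of the Drury-Arveson-type multishift, a bounded operator on
`l²(V)`. -/
def shift (a : ℕ) (j : Fin d) : T.L2 →L[ℂ] T.L2 :=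
  LinearMap.mkContinuous
    { toFun := fun f => ⟨T.shiftFun a j f, T.memℓp_shiftFun a j f⟩
      map_add' := fun f g => by
        ext w
        simp only [shiftFun, lp.coeFn_add, Pi.add_apply]
        split_ifs <;> ring
      map_smul' := fun c f => by
        ext w
        simp only [shiftFun, lp.coeFn_smul, Pi.smul_apply, smul_eq_mul, RingHom.id_apply]
        split_ifs <;> ring }
    (√(d + 1)) (fun f => by
      refine lp.norm_le_of_forall_sum_le (by norm_num) (by positivity) fun s => ?_
      have := T.sum_norm_shiftFun_sq_le a j f s
      simpa [mul_pow, Real.sq_sqrt (show (0 : ℝ) ≤ (d : ℝ) + 1 by positivity)] using this)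

/-- The joint cokernel `E = ⋂_j ker S_j^*` of the multishift. -/
def E (a : ℕ) : Submodule ℂ T.L2 := ⨅ j, (ContinuousLinearMap.adjoint (T.shift a j)).ker

lemma isClosed_E (a : ℕ) : IsClosed (T.E a : Set T.L2) := by
  simp only [E, Submodule.coe_iInf]
  exact isClosed_iInter fun j => ContinuousLinearMap.isClosed_ker _

instance (a : ℕ) : CompleteSpace (T.E a) := (T.isClosed_E a).completeSpace_coe

/-- `Φ_F`: the vertices whose coordinate `j` differs from the root exactly for `j ∈ F`. -/
def Phi (F : Finset (Fin d)) : Set T.Vert := {v | ∀ j, v j ≠ (T.tree j).root ↔ j ∈ F}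

/-- `sib_F(u)` for `u ∈ Φ_F`: the vertices of `Φ_F` whose coordinate `j` is a sibling of `u j`
(that is, has the same parent) for each `j ∈ F`. -/
def sib (F : Finset (Fin d)) (u : T.Vert) : Set T.Vert :=
  {v | v ∈ T.Phi F ∧ ∀ j ∈ F, (T.tree j).parent (v j) = (T.tree j).parent (u j)}

/-- The equivalence relation `u ∼ v ↔ u ∈ sib_F(v)` on `Φ_F`. -/
def sibSetoid (F : Finset (Fin d)) : Setoid (T.Phi F) where
  r u v := (u : T.Vert) ∈ T.sib F v
  iseqv :=
    { refl := fun u => ⟨u.2, fun _ _ => rfl⟩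
      symm := fun {_ v} h => ⟨v.2, fun j hj => (h.2 j hj).symm⟩
      trans := fun {u _ _} h h' => ⟨u.2, fun j hj => (h.2 j hj).trans (h'.2 j hj)⟩ }

/-- The indexing set `Ω_F`: one (chosen) element from each of the classes `sib_F(u)`,
`u ∈ Φ_F`. -/
def Omega (F : Finset (Fin d)) : Set T.Vert :=
  Set.range fun q : Quotient (T.sibSetoid F) => ((Quotient.out q : T.Phi F) : T.Vert)

/-- The space `L_{u,F}`, as a subspace of `E`: the functions supported on `sib_F(u)` that satisfy
`∑ f(w) λ_j(w) = 0` for all `j ∈ F` and `v ∈ sib_F(u)`, where `w` runs over the vertices obtained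
from `v` when the coordinate `j` is replaced by any sibling `η` of `u j`. -/
def L (a : ℕ) (F : Finset (Fin d)) (u : T.Vert) : Submodule ℂ (T.E a) where
  carrier := {f | (∀ w, w ∉ T.sib F u → (f : T.L2) w = 0) ∧
    ∀ j ∈ F, ∀ v ∈ T.sib F u, ∑ η ∈ T.childFinset j ((T.tree j).parent (u j)),
      (f : T.L2) (Function.update v j η) * (T.weight a j (Function.update v j η) : ℂ) = 0}
  zero_mem' := by simp
  add_mem' := by
    rintro f g ⟨hf, hf'⟩ ⟨hg, hg'⟩
    refine ⟨fun w hw => by simp [hf w hw, hg w hw], fun j hj v hv => ?_⟩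
    simp [add_mul, Finset.sum_add_distrib, hf' j hj v hv, hg' j hj v hv]
  smul_mem' := by
    rintro c f ⟨hf, hf'⟩
    refine ⟨fun w hw => by simp [hf w hw], fun j hj v hv => ?_⟩
    simp [mul_assoc, ← Finset.mul_sum, hf' j hj v hv]

lemma isClosed_L (a : ℕ) (F : Finset (Fin d)) (u : T.Vert) :
    IsClosed (T.L a F u : Set (T.E a)) := by
  classical
  have hev : ∀ w : T.Vert, Continuous fun f : T.E a => (f : T.L2) w := fun w =>
    (lp.evalCLM ℂ (fun _ : T.Vert => ℂ) 2 w).continuous.comp continuous_subtype_val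
  have e : (T.L a F u : Set (T.E a)) =
      (⋂ w, ⋂ (_ : w ∉ T.sib F u), {f : T.E a | (f : T.L2) w = 0}) ∩
      ⋂ j, ⋂ (_ : j ∈ F), ⋂ v, ⋂ (_ : v ∈ T.sib F u),
        {f : T.E a | ∑ η ∈ T.childFinset j ((T.tree j).parent (u j)),
          (f : T.L2) (Function.update v j η) *
            (T.weight a j (Function.update v j η) : ℂ) = 0} := by
    ext f
    simp [L]
  rw [e]
  refine IsClosed.inter ?_ ?_
  · exact isClosed_iInter fun w => isClosed_iInter fun _ => isClosed_eq (hev w) continuous_const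
  · exact isClosed_iInter fun j => isClosed_iInter fun _ => isClosed_iInter fun v =>
      isClosed_iInter fun _ => isClosed_eq
        (continuous_finsetSum _ fun η _ => (hev _).mul continuous_const) continuous_const

instance (a : ℕ) (F : Finset (Fin d)) (u : T.Vert) : CompleteSpace (T.L a F u) :=
  (T.isClosed_L a F u).completeSpace_coe

end TreeProduct

/-- The open unit ball of `ℂ^d`, with the Euclidean norm. -/
abbrev UnitBall (d : ℕ) : Type := Metric.ball (0 : EuclideanSpace ℂ (Fin d)) 1

/-- The monomial `z^α`. -/
def monomial {d : ℕ} (z : UnitBall d) (α : Fin d → ℕ) : ℂ :=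
  ∏ i, (z : EuclideanSpace ℂ (Fin d)) i ^ α i

/-- The multiindex factorial `α!`. -/
def mfactorial {d : ℕ} (α : Fin d → ℕ) : ℕ := ∏ i, (α i).factorial

/-- The scalar kernel
`∑_α δ! / (δ + α)! * (∏_{j < |α|} (|δ| + a + j)) z^α conj(w)^α` on the unit ball. -/
def scalarKernel {d : ℕ} (a : ℕ) (δ : Fin d → ℕ) (z w : UnitBall d) : ℂ :=
  ∑' α : Fin d → ℕ, ((mfactorial δ : ℂ) / (mfactorial (δ + α) : ℂ)) *
    (∏ j ∈ Finset.range (∑ i, α i), (((∑ i, δ i : ℕ) : ℂ) + a + j)) *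
    monomial z α * (starRingEnd ℂ) (monomial w α)

/-- The operator-valued kernel on the unit ball
`κ(z, w) = ∑_F ∑_{u ∈ Ω_F} k_{d_u}(z, w) P_{L_{u,F}}`, where `k_δ` is the scalar kernel and
`P` denotes orthogonal projections in `E`. -/
def TreeProduct.kernel {d : ℕ} (T : TreeProduct d) (a : ℕ) :
    Matrix (UnitBall d) (UnitBall d) (T.E a →L[ℂ] T.E a) :=
  Matrix.of fun z w => ∑ F : Finset (Fin d), ∑' u : T.Omega F,
    scalarKernel a (T.depth u) z w • (T.L a F u).starProjection

/-- The Drury-Arveson-type Hilbert module of `T`: the reproducing kernel Hilbert space of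
`E`-valued functions on the unit ball with the kernel `κ`, with the operators `M_{z_k}` of
multiplication by the coordinate functions. A reproducing kernel Hilbert space is determined by its
kernel (as a space of functions, with its inner product), and `M` is determined by `M_apply`; so
there is at most one such module up to canonical isomorphism. -/
structure HilbertModule {d : ℕ} (a : ℕ) (T : TreeProduct d) where
  /-- the underlying space -/
  H : Type
  [normed : NormedAddCommGroup H]
  [inner : InnerProductSpace ℂ H]
  [complete : CompleteSpace H]
  [rkhs : RKHS ℂ H (UnitBall d) (T.E a)]
  kernel_eq : RKHS.kernel H = T.kernel a
  /-- the multiplication operators -/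
  M : Fin d → H →L[ℂ] H
  M_apply : ∀ (k : Fin d) (f : H) (z : UnitBall d),
    M k f z = (z : EuclideanSpace ℂ (Fin d)) k • f z

attribute [instance] HilbertModule.normed HilbertModule.inner HilbertModule.complete
  HilbertModule.rkhs

/-- Isomorphism of Hilbert modules: a unitary map that intertwines the multiplication operators. -/
def HilbertModule.Iso {d a : ℕ} {T T' : TreeProduct d} (X : HilbertModule a T)
    (Y : HilbertModule a T') : Prop :=
  ∃ U : X.H ≃ₗᵢ[ℂ] Y.H, ∀ (k : Fin d) (f : X.H), U (X.M k f) = Y.M k (U f)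

end DruryArveson

end

/-! In an orthonormal basis of `E` whose vectors are each supported on one sibling class, the kernel
is diagonal: a vector of degree `δ` contributes the scalar kernel with parameter `δ`. The module is
then an orthogonal sum of scalar modules, determined up to isomorphism by the family of degrees. The
rest of the geometry of the trees is invisible to it.

It suffices to use products of one "bush" with `d - 1` paths. On the paths every `f ∈ E` is
concentrated at the root, because membership in `E` means that the values at the children of each
vertex in each direction sum to zero. Hence `E` is spanned by the point mass at the root and, for
each branching vertex `v` of the bush, by a space of dimension `card Chi(v) - 1` and degree one more
than the depth of `v`. The space is realized concretely as `ModelSpace`, the `ℓ²` space of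
coefficients against normalized monomials, with weighted shifts as multiplication operators
(`kernel_apply_basis`, `modelModule`).

For infinitely many classes, the invariant is the dimension of the joint cokernel of the
multiplication operators, which equals `dim E` (`finrank_jointCokernel_modelShift`). For many graphs
with one module, a fixed number of extra children is distributed in different ways among the two
vertices of depth 1: the degrees do not change (`iso_axisModule`), but the maximal number of
children does (`not_graphIso_bushProduct`). -/

noncomputable section

namespace DruryArveson

/-! ### Scalar kernels: positivity, convergence and uniqueness of power series on the ball. -/

/-- The coefficient of `z^α conj(w)^α` in the scalar kernel. -/
def kernelCoeff {d : ℕ} (a : ℕ) (δ α : Fin d → ℕ) : ℝ :=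
  (mfactorial δ : ℝ) / (mfactorial (δ + α) : ℝ) *
    ∏ j ∈ Finset.range (∑ i, α i), (((∑ i, δ i : ℕ) : ℝ) + a + j)

lemma mfactorial_pos {d : ℕ} (α : Fin d → ℕ) : 0 < mfactorial α :=
  Finset.prod_pos fun _ _ => Nat.factorial_pos _

lemma kernelCoeff_pos {d a : ℕ} (ha : 0 < a) (δ α : Fin d → ℕ) : 0 < kernelCoeff a δ α := by
  have h1 := mfactorial_pos δ
  have h2 := mfactorial_pos (δ + α)
  unfold kernelCoeff
  refine mul_pos (by positivity) (Finset.prod_pos fun j _ => by positivity)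

/-- The product is a rising factorial, equal to `n! * (n + A).choose A` with `n = |α|`, and `δ! α! ≤
(δ + α)!`. The bound is shaped for the multinomial theorem followed by the negative binomial series.
-/
lemma kernelCoeff_le {d a A : ℕ} (δ : Fin d → ℕ) (hA : (∑ i, δ i) + a = A + 1) (α : Fin d → ℕ) :
    kernelCoeff a δ α ≤
      ((∑ i, α i + A).choose A : ℝ) * (Nat.multinomial Finset.univ α : ℝ) := by
  have h1 := mfactorial_pos δ
  have h2 := mfactorial_pos α
  have h3 := mfactorial_pos (δ + α)
  have hle : mfactorial δ * mfactorial α ≤ mfactorial (δ + α) := by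
    unfold mfactorial
    rw [← Finset.prod_mul_distrib]
    exact Finset.prod_le_prod' fun i _ => Nat.le_of_dvd (Nat.factorial_pos _)
      (Nat.factorial_mul_factorial_dvd_factorial_add _ _)
  set n := ∑ i, α i with hn
  have hprod : ∏ j ∈ Finset.range n, (((∑ i, δ i : ℕ) : ℝ) + a + j) =
      (n.factorial : ℝ) * ((n + A).choose A : ℝ) := by
    have e : (A + 1).ascFactorial n = n.factorial * (n + A).choose A := by
      rw [Nat.ascFactorial_eq_factorial_mul_choose, add_comm A n, Nat.choose_symm_add]
    rw [Nat.ascFactorial_eq_prod_range, ← hA] at e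
    exact_mod_cast e
  have hmult : (mfactorial α : ℝ) * (Nat.multinomial Finset.univ α : ℝ) = n.factorial := by
    have := Nat.multinomial_spec Finset.univ α
    exact_mod_cast this
  have hq : (mfactorial δ : ℝ) / mfactorial (δ + α) ≤ 1 / mfactorial α := by
    rw [div_le_div_iff₀ (by positivity) (by positivity)]
    rw [one_mul]; exact_mod_cast hle
  unfold kernelCoeff
  rw [← hn, hprod, ← hmult]
  calc _ ≤ 1 / (mfactorial α : ℝ) *
        (mfactorial α * (Nat.multinomial Finset.univ α : ℝ) * ((n + A).choose A : ℝ)) := by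
        gcongr
    _ = _ := by
        have : (mfactorial α : ℝ) ≠ 0 := by positivity
        field_simp

lemma summable_kernelCoeff {d a : ℕ} (ha : 0 < a) (δ : Fin d → ℕ) (x : Fin d → ℝ)
    (hx : ∀ i, 0 ≤ x i) (hx1 : ∑ i, x i < 1) :
    Summable fun α : Fin d → ℕ => kernelCoeff a δ α * ∏ i, x i ^ α i := by
  classical
  obtain ⟨A, hA⟩ : ∃ A, (∑ i, δ i) + a = A + 1 := ⟨(∑ i, δ i) + a - 1, by omega⟩
  have hs0 : 0 ≤ ∑ i, x i := Finset.sum_nonneg fun i _ => hx i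
  have hsum := summable_choose_mul_geometric_of_norm_lt_one (R := ℝ) A (r := ∑ i, x i)
    (by rwa [Real.norm_eq_abs, abs_of_nonneg hs0])
  have hnn : ∀ α : Fin d → ℕ, 0 ≤ kernelCoeff a δ α * ∏ i, x i ^ α i := fun α =>
    mul_nonneg (kernelCoeff_pos ha δ α).le (Finset.prod_nonneg fun i _ => pow_nonneg (hx i) _)
  refine summable_of_sum_le hnn (c := ∑' n : ℕ, ((n + A).choose A : ℝ) * (∑ i, x i) ^ n)
    fun s => ?_
  -- Grouped by `|α| = n`, the terms are bounded through the multinomial theorem by `(n + A).choose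
  -- A * (∑ x i) ^ n`.
  rw [← Finset.sum_fiberwise_of_maps_to (t := s.image fun α => ∑ i, α i) (g := fun α => ∑ i, α i)
    (fun α hα => Finset.mem_image_of_mem _ hα)]
  refine le_trans (Finset.sum_le_sum fun n _ => ?_)
    (hsum.sum_le_tsum _ fun n _ => by positivity)
  rw [Finset.sum_pow_eq_sum_piAntidiag, Finset.mul_sum]
  refine le_trans (Finset.sum_le_sum (g := fun α => ((n + A).choose A : ℝ) *
    ((Nat.multinomial Finset.univ α : ℝ) * ∏ i, x i ^ α i)) fun α hα => ?_) ?_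
  · have h := kernelCoeff_le δ hA α
    rw [(Finset.mem_filter.1 hα).2] at h
    rw [← mul_assoc]
    exact mul_le_mul_of_nonneg_right h (Finset.prod_nonneg fun i _ => pow_nonneg (hx i) _)
  · refine Finset.sum_le_sum_of_subset_of_nonneg (fun α hα => ?_) fun α _ _ => ?_
    · simp [Finset.mem_piAntidiag, (Finset.mem_filter.1 hα).2]
    · have : 0 ≤ ∏ i, x i ^ α i := Finset.prod_nonneg fun i _ => pow_nonneg (hx i) _
      positivity

/-- A power series in several variables that vanishes on the unit ball has zero coefficients. -/
lemma coeff_eq_zero_of_vanish {d : ℕ} (b : (Fin d → ℕ) → ℂ)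
    (h : ∀ z : UnitBall d, HasSum (fun α => b α * monomial z α) 0) : b = 0 := by
  classical
  -- Restriction to the complex line `t ↦ t ζ` turns the homogeneous parts at `ζ` into the
  -- coefficients of a one-variable series that vanishes near 0. Only small `t` matter, so `ζ` need
  -- not lie in the ball.
  have hP : ∀ (n : ℕ) (ζ : Fin d → ℂ),
      ∑ α ∈ Finset.piAntidiag Finset.univ n, b α * ∏ i, ζ i ^ α i = 0 := by
    intro n ζ
    set c : ℕ → ℂ := fun n => ∑ α ∈ Finset.piAntidiag Finset.univ n, b α * ∏ i, ζ i ^ α i with hc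
    have hev : ∀ᶠ t : ℂ in nhds 0, t • WithLp.toLp 2 ζ ∈
        Metric.ball (0 : EuclideanSpace ℂ (Fin d)) 1 := by
      have hcont : Continuous fun t : ℂ => t • WithLp.toLp 2 ζ := by fun_prop
      exact hcont.continuousAt.eventually_mem (by simpa using Metric.ball_mem_nhds _ one_pos)
    have hps : HasFPowerSeriesAt (0 : ℂ → ℂ) (FormalMultilinearSeries.ofScalars ℂ c) 0 := by
      rw [hasFPowerSeriesAt_iff]
      filter_upwards [hev] with t ht
      have h1 := (h ⟨_, ht⟩).tsum_fiberwise (fun α => ∑ i, α i)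
      convert! h1 using 2 with m
      rw [FormalMultilinearSeries.coeff_ofScalars, hc]
      have e : (fun α : Fin d → ℕ => ∑ i, α i) ⁻¹' {m} =
          ((Finset.piAntidiag Finset.univ m : Finset (Fin d → ℕ)) : Set (Fin d → ℕ)) := by
        ext α; simp [Finset.mem_piAntidiag]
      rw [e, Finset.tsum_subtype' _ (fun α => b α * monomial ⟨_, ht⟩ α), smul_eq_mul,
        Finset.mul_sum]
      refine Finset.sum_congr rfl fun α hα => ?_
      have hm : ∑ i, α i = m := by simpa [Finset.mem_piAntidiag] using hα
      simp only [monomial, PiLp.smul_apply, smul_eq_mul, mul_pow, Finset.prod_mul_distrib,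
        Finset.prod_pow_eq_pow_sum, hm]
      ring
    have h2 : (FormalMultilinearSeries.ofScalars ℂ c).coeff n = 0 := by
      rw [hps.eq_zero]; rfl
    rwa [FormalMultilinearSeries.coeff_ofScalars] at h2
  funext α
  set n := ∑ i, α i with hn
  -- Each homogeneous part is now a polynomial that vanishes on all of `ℂ^d`.
  let p : MvPolynomial (Fin d) ℂ := ∑ β ∈ Finset.piAntidiag Finset.univ n,
    MvPolynomial.monomial (Finsupp.equivFunOnFinite.symm β) (b β)
  have hp : p = 0 := by
    refine MvPolynomial.funext fun ζ => ?_
    rw [map_zero, ← hP n ζ]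
    simp [p, MvPolynomial.eval_monomial, Finsupp.prod_fintype]
  have hcoef := congrArg (MvPolynomial.coeff (Finsupp.equivFunOnFinite.symm α)) hp
  simpa [p, MvPolynomial.coeff_sum, MvPolynomial.coeff_monomial, Finset.mem_piAntidiag, ← hn]
    using hcoef

end DruryArveson
end

/-! ### The model space as a reproducing kernel Hilbert space. -/

noncomputable section

namespace DruryArveson

open scoped InnerProductSpace

/-- The Hilbert space of the coefficients with respect to normalized monomials. -/
abbrev ModelSpace (ι : Type) (d : ℕ) : Type := lp (fun _ : ι × (Fin d → ℕ) => ℂ) 2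

lemma hasSum_norm_sq {ι : Type} (f : lp (fun _ : ι => ℂ) 2) :
    HasSum (fun p => ‖f p‖ ^ 2) (‖f‖ ^ 2) := by
  simpa using lp.hasSum_norm (p := 2) (by norm_num) f

lemma norm_monomial_sq {d : ℕ} (z : UnitBall d) (α : Fin d → ℕ) :
    ‖monomial z α‖ ^ 2 = ∏ i, (‖(z : EuclideanSpace ℂ (Fin d)) i‖ ^ 2) ^ α i := by
  simp only [monomial, norm_prod, norm_pow, ← Finset.prod_pow]
  exact Finset.prod_congr rfl fun i _ => by ring

lemma sum_coord_sq_lt_one {d : ℕ} (z : UnitBall d) :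
    ∑ i, ‖(z : EuclideanSpace ℂ (Fin d)) i‖ ^ 2 < 1 := by
  have h : ‖(z : EuclideanSpace ℂ (Fin d))‖ < 1 := mem_ball_zero_iff.1 z.2
  rw [← EuclideanSpace.norm_sq_eq]
  nlinarith [norm_nonneg (z : EuclideanSpace ℂ (Fin d))]

section Model

variable {ι : Type} {d a : ℕ}

open scoped Classical in
/-- The coefficients of the `i`-th component of the kernel function at `z`. -/
def kernelVecFun (a : ℕ) (δ : ι → Fin d → ℕ) (z : UnitBall d) (i : ι) (p : ι × (Fin d → ℕ)) : ℂ :=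
  if p.1 = i then (√(kernelCoeff a (δ i) p.2) : ℂ) * (starRingEnd ℂ) (monomial z p.2) else 0

lemma kernelVecFun_self (δ : ι → Fin d → ℕ) (z : UnitBall d) (i : ι) (α : Fin d → ℕ) :
    kernelVecFun a δ z i (i, α) =
      (√(kernelCoeff a (δ i) α) : ℂ) * (starRingEnd ℂ) (monomial z α) := by
  simp [kernelVecFun]

lemma kernelVecFun_ne (δ : ι → Fin d → ℕ) (z : UnitBall d) {i : ι} {p : ι × (Fin d → ℕ)}
    (h : p.1 ≠ i) : kernelVecFun a δ z i p = 0 := by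
  simp [kernelVecFun, h]

lemma mk_injective (i : ι) : Function.Injective fun α : Fin d → ℕ => (i, α) :=
  fun _ _ h => (Prod.mk.inj h).2

lemma memℓp_kernelVecFun (ha : 0 < a) (δ : ι → Fin d → ℕ) (z : UnitBall d) (i : ι) :
    Memℓp (kernelVecFun a δ z i) 2 := by
  refine memℓp_gen ?_
  rw [← (mk_injective i).summable_iff]
  · refine (summable_kernelCoeff ha (δ i) _ (fun j => sq_nonneg _)
      (sum_coord_sq_lt_one z)).congr fun α => ?_
    rw [← norm_monomial_sq, Function.comp_apply, kernelVecFun_self]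
    simp [mul_pow, Real.sq_sqrt (kernelCoeff_pos ha (δ i) α).le]
  · intro p hp
    rw [kernelVecFun_ne δ z fun h => hp ⟨p.2, by rw [← h]⟩]
    simp

/-- The `i`-th component of the kernel function at `z`. -/
def kernelVec (ha : 0 < a) (δ : ι → Fin d → ℕ) (z : UnitBall d) (i : ι) : ModelSpace ι d :=
  ⟨kernelVecFun a δ z i, memℓp_kernelVecFun ha δ z i⟩

/-- Pairing with `kernelVec` is evaluation at `z` of the `i`-th component: `f (i, α)` is the
coordinate against the normalized monomial `√(kernelCoeff a (δ i) α) z^α`. -/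
lemma hasSum_inner_kernelVec (ha : 0 < a) (δ : ι → Fin d → ℕ) (z : UnitBall d) (i : ι)
    (f : ModelSpace ι d) :
    HasSum (fun α => ((√(kernelCoeff a (δ i) α) : ℂ) * f (i, α)) * monomial z α)
      ⟪kernelVec ha δ z i, f⟫_ℂ := by
  have h := lp.hasSum_inner (𝕜 := ℂ) (kernelVec ha δ z i) f
  rw [← (mk_injective i).hasSum_iff] at h
  · convert! h using 2 with α
    simp only [kernelVec, Function.comp_apply, kernelVecFun_self, RCLike.inner_apply, map_mul,
      Complex.conj_ofReal, Complex.conj_conj]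
    ring
  · intro p hp
    have : kernelVecFun a δ z i p = 0 :=
      kernelVecFun_ne δ z fun h => hp ⟨p.2, by rw [← h]⟩
    simp [kernelVec, this]

lemma inner_kernelVec_ne (ha : 0 < a) (δ : ι → Fin d → ℕ) (z w : UnitBall d) {i j : ι}
    (hij : i ≠ j) : ⟪kernelVec ha δ z i, kernelVec ha δ w j⟫_ℂ = 0 := by
  refine (hasSum_inner_kernelVec ha δ z i _).unique ?_
  convert! hasSum_zero (α := ℂ) (β := Fin d → ℕ) using 2 with α
  have : kernelVecFun a δ w j (i, α) = 0 := kernelVecFun_ne δ w hij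
  simp [kernelVec, this]

lemma inner_kernelVec_self (ha : 0 < a) (δ : ι → Fin d → ℕ) (z w : UnitBall d) (i : ι) :
    ⟪kernelVec ha δ z i, kernelVec ha δ w i⟫_ℂ = scalarKernel a (δ i) z w := by
  rw [← (hasSum_inner_kernelVec ha δ z i _).tsum_eq, scalarKernel]
  refine tsum_congr fun α => ?_
  simp only [kernelVec, kernelVecFun_self]
  rw [← mul_assoc, ← Complex.ofReal_mul, Real.mul_self_sqrt (kernelCoeff_pos ha (δ i) α).le]
  simp only [kernelCoeff]
  push_cast
  ring

variable [Fintype ι] {V : Type} [NormedAddCommGroup V] [InnerProductSpace ℂ V]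

/-- The evaluation at `z` of the functions that correspond to elements of the model space. -/
def modelEval (ha : 0 < a) (δ : ι → Fin d → ℕ) (b : OrthonormalBasis ι ℂ V) (z : UnitBall d) :
    ModelSpace ι d →L[ℂ] V :=
  ∑ i, (innerSL ℂ (kernelVec ha δ z i)).smulRight (b i)

lemma modelEval_apply (ha : 0 < a) (δ : ι → Fin d → ℕ) (b : OrthonormalBasis ι ℂ V)
    (z : UnitBall d) (f : ModelSpace ι d) :
    modelEval ha δ b z f = ∑ i, ⟪kernelVec ha δ z i, f⟫_ℂ • b i := by
  simp [modelEval]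

/-- The model space as a reproducing kernel Hilbert space of functions on the unit ball. -/
@[reducible]
def modelRKHS (ha : 0 < a) (δ : ι → Fin d → ℕ) (b : OrthonormalBasis ι ℂ V) :
    RKHS ℂ (ModelSpace ι d) (UnitBall d) V where
  coeCLM := ContinuousLinearMap.pi (modelEval ha δ b)
  coeCLM_injective := by
    refine (injective_iff_map_eq_zero _).2 fun f hf => ?_
    have h0 : ∀ z i, ⟪kernelVec ha δ z i, f⟫_ℂ = 0 := fun z i => by
      have h := congrFun hf z
      simp only [ContinuousLinearMap.coe_pi', modelEval_apply, Pi.zero_apply] at h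
      exact Fintype.linearIndependent_iff.1 b.orthonormal.linearIndependent _ h i
    ext ⟨i, α⟩
    have h1 := congrFun (coeff_eq_zero_of_vanish _ fun z => by
      have := hasSum_inner_kernelVec ha δ z i f
      rwa [h0 z i] at this) α
    have h2 : √(kernelCoeff a (δ i) α) ≠ 0 := (Real.sqrt_pos.2 (kernelCoeff_pos ha (δ i) α)).ne'
    simpa [h2] using h1

/-- The reproducing property forces the kernel function at `w` in the direction `b i` to be
`kernelVec ha δ w i`. Its values have only an `i`-th component, since different components are
orthogonal. -/
lemma kernel_model_apply [CompleteSpace V] (ha : 0 < a) (δ : ι → Fin d → ℕ)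
    (b : OrthonormalBasis ι ℂ V) (z w : UnitBall d) (i : ι) :
    letI := modelRKHS ha δ b
    RKHS.kernel (ModelSpace ι d) z w (b i) = scalarKernel a (δ i) z w • b i := by
  let _ := modelRKHS ha δ b
  have h : RKHS.kerFun (ModelSpace ι d) w (b i) = kernelVec ha δ w i := by
    classical
    refine ext_inner_right ℂ fun f => ?_
    rw [RKHS.kerFun_inner]
    change ⟪b i, modelEval ha δ b w f⟫_ℂ = _
    rw [modelEval_apply, inner_sum]
    simp [inner_smul_right, b.inner_eq_ite]
  rw [← RKHS.kerFun_apply, h]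
  change modelEval ha δ b z _ = _
  rw [modelEval_apply, Finset.sum_eq_single i, inner_kernelVec_self]
  · intro j _ hj
    rw [inner_kernelVec_ne ha δ z w hj, zero_smul]
  · simp

end Model

end DruryArveson
end

/-! ### Multiplication operators as weighted shifts, and their joint cokernel. -/

noncomputable section

namespace DruryArveson

open scoped InnerProductSpace

section ModelShift

variable {ι : Type} {d a : ℕ}

/-- Multiplication by `z_k` raises the exponent of a monomial. -/
def raise (k : Fin d) (p : ι × (Fin d → ℕ)) : ι × (Fin d → ℕ) := (p.1, p.2 + Pi.single k 1)

lemma raise_injective (k : Fin d) : Function.Injective (raise k : ι × (Fin d → ℕ) → _) := by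
  rintro ⟨i, α⟩ ⟨j, β⟩ h
  obtain ⟨h1, h2⟩ := Prod.mk.inj h
  exact Prod.ext h1 (add_right_cancel h2)

/-- The weights of the multiplication by `z_k` with respect to normalized monomials. -/
def modelWeight (a : ℕ) (δ : ι → Fin d → ℕ) (k : Fin d) (p : ι × (Fin d → ℕ)) : ℝ :=
  √(kernelCoeff a (δ p.1) p.2) / √(kernelCoeff a (δ p.1) (p.2 + Pi.single k 1))

lemma modelWeight_pos (ha : 0 < a) (δ : ι → Fin d → ℕ) (k : Fin d) (p : ι × (Fin d → ℕ)) :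
    0 < modelWeight a δ k p :=
  div_pos (Real.sqrt_pos.2 (kernelCoeff_pos ha _ _)) (Real.sqrt_pos.2 (kernelCoeff_pos ha _ _))

lemma mfactorial_add_single (α : Fin d → ℕ) (k : Fin d) :
    mfactorial (α + Pi.single k 1) = mfactorial α * (α k + 1) := by
  classical
  unfold mfactorial
  rw [← Finset.mul_prod_erase _ _ (Finset.mem_univ k),
    ← Finset.mul_prod_erase _ (fun i => (α i).factorial) (Finset.mem_univ k),
    Finset.prod_congr rfl (g := fun i => (α i).factorial) fun i hi => by
      simp [(Finset.mem_erase.1 hi).1]]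
  simp [Nat.factorial_succ]
  ring

/-- The quotient of the two coefficients is `(|δ| + a + |α|) / (δ k + α k + 1)`, which is at least 1
because `a ≥ 1`. This makes the weighted shifts contractions. -/
lemma kernelCoeff_le_succ (δ α : Fin d → ℕ) (ha : 0 < a) (k : Fin d) :
    kernelCoeff a δ α ≤ kernelCoeff a δ (α + Pi.single k 1) := by
  have h1 : ∑ i, (α + Pi.single k 1 : Fin d → ℕ) i = ∑ i, α i + 1 := by
    simp [Finset.sum_add_distrib]
  have h2 := mfactorial_pos (δ + α)
  have h3 : (δ + α) k ≤ ∑ i, δ i + ∑ i, α i := by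
    rw [← Finset.sum_add_distrib]
    exact Finset.single_le_sum (f := δ + α) (fun _ _ => Nat.zero_le _) (Finset.mem_univ k)
  have h4 : (((δ + α) k + 1 : ℕ) : ℝ) ≤ ((∑ i, δ i : ℕ) : ℝ) + a + (∑ i, α i : ℕ) := by
    have : (δ + α) k + 1 ≤ ∑ i, δ i + a + ∑ i, α i := by omega
    exact_mod_cast this
  unfold kernelCoeff
  rw [h1, Finset.prod_range_succ, ← add_assoc, mfactorial_add_single]
  set P := ∏ j ∈ Finset.range (∑ i, α i), (((∑ i, δ i : ℕ) : ℝ) + a + j) with hP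
  have hP0 : 0 ≤ P := Finset.prod_nonneg fun j _ => by positivity
  set m : ℕ := (δ + α) k + 1
  have hm : (0 : ℝ) < m := by positivity
  push_cast
  calc (mfactorial δ : ℝ) / mfactorial (δ + α) * P
      = (mfactorial δ : ℝ) / (mfactorial (δ + α) * m) * (P * m) := by field_simp
    _ ≤ _ := by
      push_cast at h4
      gcongr

lemma modelWeight_le_one (ha : 0 < a) (δ : ι → Fin d → ℕ) (k : Fin d) (p : ι × (Fin d → ℕ)) :
    modelWeight a δ k p ≤ 1 :=
  div_le_one_of_le₀ (Real.sqrt_le_sqrt (kernelCoeff_le_succ _ _ ha k)) (Real.sqrt_nonneg _)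

/-- The function underlying the model of the multiplication by `z_k`. -/
def modelShiftFun (a : ℕ) (δ : ι → Fin d → ℕ) (k : Fin d) (f : ι × (Fin d → ℕ) → ℂ) :
    ι × (Fin d → ℕ) → ℂ :=
  Function.extend (raise k) (fun p => (modelWeight a δ k p : ℂ) * f p) 0

lemma modelShiftFun_raise (δ : ι → Fin d → ℕ) (k : Fin d) (f : ι × (Fin d → ℕ) → ℂ)
    (p : ι × (Fin d → ℕ)) :
    modelShiftFun a δ k f (raise k p) = modelWeight a δ k p * f p :=
  (raise_injective k).extend_apply _ _ p

lemma modelShiftFun_of_notMem (δ : ι → Fin d → ℕ) (k : Fin d) (f : ι × (Fin d → ℕ) → ℂ)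
    {q : ι × (Fin d → ℕ)} (hq : q ∉ Set.range (raise k)) : modelShiftFun a δ k f q = 0 :=
  Function.extend_apply' _ _ _ hq

lemma sum_norm_modelShiftFun_sq_le (ha : 0 < a) (δ : ι → Fin d → ℕ) (k : Fin d)
    (f : ModelSpace ι d) (s : Finset (ι × (Fin d → ℕ))) :
    ∑ q ∈ s, ‖modelShiftFun a δ k f q‖ ^ 2 ≤ ‖f‖ ^ 2 := by
  have hle : ∀ p, ‖modelShiftFun a δ k f (raise k p)‖ ^ 2 ≤ ‖f p‖ ^ 2 := fun p => by
    rw [modelShiftFun_raise, norm_mul, Complex.norm_real, Real.norm_eq_abs,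
      abs_of_pos (modelWeight_pos ha δ k p)]
    have := mul_le_of_le_one_left (norm_nonneg (f p)) (modelWeight_le_one ha δ k p)
    have := modelWeight_pos ha δ k p
    gcongr
  have hf := hasSum_norm_sq f
  have hs : Summable fun p => ‖modelShiftFun a δ k f (raise k p)‖ ^ 2 :=
    Summable.of_nonneg_of_le (fun _ => sq_nonneg _) hle hf.summable
  have hs' := ((raise_injective k).hasSum_iff (f := fun q => ‖modelShiftFun a δ k f q‖ ^ 2)
    fun q hq => by simp [modelShiftFun_of_notMem δ k f hq]).1 hs.hasSum
  calc _ ≤ _ := sum_le_hasSum s (fun _ _ => sq_nonneg _) hs'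
    _ ≤ _ := hasSum_le hle hs.hasSum hf

/-- The model of the multiplication by `z_k`. -/
def modelShift (ha : 0 < a) (δ : ι → Fin d → ℕ) (k : Fin d) :
    ModelSpace ι d →L[ℂ] ModelSpace ι d :=
  LinearMap.mkContinuous
    { toFun := fun f => ⟨modelShiftFun a δ k f, memℓp_gen' (C := ‖f‖ ^ 2) fun s => by
        simpa using sum_norm_modelShiftFun_sq_le ha δ k f s⟩
      map_add' := fun f g => by
        ext q
        by_cases hq : q ∈ Set.range (raise k)
        · obtain ⟨p, rfl⟩ := hq
          simp only [lp.coeFn_add, Pi.add_apply, modelShiftFun_raise, mul_add]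
        · simp only [lp.coeFn_add, Pi.add_apply, modelShiftFun_of_notMem δ k _ hq, add_zero]
      map_smul' := fun c f => by
        ext q
        by_cases hq : q ∈ Set.range (raise k)
        · obtain ⟨p, rfl⟩ := hq
          simp [modelShiftFun_raise, mul_left_comm]
        · simp [modelShiftFun_of_notMem δ k _ hq] }
    1 fun f => by
      refine lp.norm_le_of_forall_sum_le (by norm_num) (by positivity) fun s => ?_
      simpa using sum_norm_modelShiftFun_sq_le ha δ k f s

lemma hasSum_inner_modelShift (ha : 0 < a) (δ : ι → Fin d → ℕ) (k : Fin d)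
    (g f : ModelSpace ι d) :
    HasSum (fun p => (modelWeight a δ k p * f p) * (starRingEnd ℂ) (g (raise k p)))
      ⟪g, modelShift ha δ k f⟫_ℂ := by
  have h := lp.hasSum_inner (𝕜 := ℂ) g (modelShift ha δ k f)
  rw [← (raise_injective k).hasSum_iff] at h
  · convert! h using 2 with p
    simp only [modelShift, LinearMap.mkContinuous_apply, LinearMap.coe_mk, AddHom.coe_mk,
      Function.comp_apply, modelShiftFun_raise, RCLike.inner_apply]
  · intro q hq
    simp [modelShift, modelShiftFun_of_notMem δ k f hq]

lemma monomial_add_single (z : UnitBall d) (k : Fin d) (α : Fin d → ℕ) :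
    monomial z (α + Pi.single k 1) = (z : EuclideanSpace ℂ (Fin d)) k * monomial z α := by
  classical
  unfold monomial
  rw [← Finset.mul_prod_erase _ _ (Finset.mem_univ k),
    ← Finset.mul_prod_erase _ (fun i => (z : EuclideanSpace ℂ (Fin d)) i ^ α i)
      (Finset.mem_univ k),
    Finset.prod_congr rfl (g := fun i => (z : EuclideanSpace ℂ (Fin d)) i ^ α i) fun i hi => by
      simp [(Finset.mem_erase.1 hi).1]]
  simp [pow_succ]
  ring

/-- The weight is the quotient of two normalizing factors, so the factor of the raised monomial
cancels termwise and leaves `z k`. Thus `modelShift` is multiplication by a coordinate. -/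
lemma inner_kernelVec_modelShift (ha : 0 < a) (δ : ι → Fin d → ℕ) (z : UnitBall d) (i : ι)
    (k : Fin d) (f : ModelSpace ι d) :
    ⟪kernelVec ha δ z i, modelShift ha δ k f⟫_ℂ =
      (z : EuclideanSpace ℂ (Fin d)) k * ⟪kernelVec ha δ z i, f⟫_ℂ := by
  refine (hasSum_inner_modelShift ha δ k _ f).unique ?_
  have h := (lp.hasSum_inner (𝕜 := ℂ) (kernelVec ha δ z i) f).mul_left
    ((z : EuclideanSpace ℂ (Fin d)) k)
  convert! h using 2 with p
  rw [RCLike.inner_apply]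
  obtain ⟨j, α⟩ := p
  by_cases hj : j = i
  · subst hj
    have h2 : (√(kernelCoeff a (δ j) (α + Pi.single k 1)) : ℂ) ≠ 0 := by
      exact_mod_cast (Real.sqrt_pos.2 (kernelCoeff_pos ha (δ j) _)).ne'
    simp only [kernelVec, raise, kernelVecFun_self, modelWeight, map_mul, Complex.conj_ofReal,
      Complex.conj_conj, monomial_add_single]
    push_cast
    field_simp
  · have h1 : kernelVecFun a δ z i (raise k (j, α)) = 0 := kernelVecFun_ne δ z hj
    have h2 : kernelVecFun a δ z i (j, α) = 0 := kernelVecFun_ne δ z hj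
    simp [kernelVec, h1, h2]

lemma modelEval_modelShift [Fintype ι] {V : Type} [NormedAddCommGroup V] [InnerProductSpace ℂ V]
    (ha : 0 < a) (δ : ι → Fin d → ℕ) (b : OrthonormalBasis ι ℂ V) (k : Fin d)
    (f : ModelSpace ι d) (z : UnitBall d) :
    modelEval ha δ b z (modelShift ha δ k f) =
      (z : EuclideanSpace ℂ (Fin d)) k • modelEval ha δ b z f := by
  simp only [modelEval_apply, inner_kernelVec_modelShift, Finset.smul_sum, smul_smul]

/-- The joint cokernel of a tuple of operators. -/
def jointCokernel {H : Type} [NormedAddCommGroup H] [InnerProductSpace ℂ H] (M : Fin d → H →L[ℂ] H) :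
    Submodule ℂ H := ⨅ k, (M k).rangeᗮ

lemma mem_jointCokernel {H : Type} [NormedAddCommGroup H] [InnerProductSpace ℂ H]
    (M : Fin d → H →L[ℂ] H) (f : H) :
    f ∈ jointCokernel M ↔ ∀ k g, ⟪f, M k g⟫_ℂ = 0 := by
  simp [jointCokernel, Submodule.mem_iInf, Submodule.mem_orthogonal']

/-- Orthogonality to all the ranges means vanishing at every raised index. The indices that are not
raised in any direction are the `(i, 0)`, so the joint cokernel consists of the constant functions.
-/
lemma finrank_jointCokernel_modelShift [Fintype ι] (ha : 0 < a) (δ : ι → Fin d → ℕ) :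
    Module.finrank ℂ (jointCokernel (modelShift ha δ)) = Fintype.card ι := by
  classical
  let v : ι → ModelSpace ι d := fun i => lp.single 2 (i, 0) 1
  have hv : LinearIndependent ℂ v := by
    refine Orthonormal.linearIndependent (𝕜 := ℂ) (orthonormal_iff_ite.2 fun i j => ?_)
    simp only [v, lp.inner_single_left, lp.single_apply]
    by_cases h : i = j <;> simp [h]
  have e : jointCokernel (modelShift ha δ) = Submodule.span ℂ (Set.range v) := by
    apply le_antisymm
    · intro f hf
      rw [mem_jointCokernel] at hf
      have h0 : ∀ k p, f (raise k p) = 0 := fun k p => by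
        have h1 := hasSum_inner_modelShift ha δ k f (lp.single 2 p 1)
        rw [hf k] at h1
        have h2 := h1.unique (hasSum_single p fun q hq => by
          rw [lp.single_apply_ne _ _ _ hq, mul_zero, zero_mul])
        have h3 : (modelWeight a δ k p : ℂ) ≠ 0 := by
          exact_mod_cast (modelWeight_pos ha δ k p).ne'
        rw [lp.single_apply_self] at h2
        simpa [h3] using h2.symm
      have h1 : f = ∑ i, f (i, 0) • v i := by
        ext ⟨j, α⟩
        simp only [lp.coeFn_sum, Finset.sum_apply, lp.coeFn_smul, Pi.smul_apply, v]
        by_cases hα : α = 0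
        · subst hα
          rw [Finset.sum_eq_single j]
          · simp
          · intro i _ hij
            rw [lp.single_apply_ne _ _ _ (by simpa using hij.symm), smul_zero]
          · simp
        · rw [Finset.sum_eq_zero fun i _ => by
            rw [lp.single_apply_ne _ _ _ (by simp [hα]), smul_zero]]
          obtain ⟨k, hk⟩ := Function.ne_iff.1 hα
          have : (j, α) = raise k (j, α - Pi.single k 1) := by
            refine Prod.ext rfl (funext fun l => ?_)
            by_cases hl : l = k
            · subst hl
              have : α l ≠ 0 := hk
              simp [raise]; omega
            · simp [raise, hl]
          rw [this, h0]
      rw [h1]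
      exact Submodule.sum_mem _ fun i _ => Submodule.smul_mem _ _ (Submodule.subset_span ⟨i, rfl⟩)
    · rw [Submodule.span_le]
      rintro _ ⟨i, rfl⟩
      rw [SetLike.mem_coe, mem_jointCokernel]
      intro k g
      refine (hasSum_inner_modelShift ha δ k _ g).unique ?_
      convert! hasSum_zero (α := ℂ) (β := ι × (Fin d → ℕ)) using 2 with p
      have : raise k p ≠ (i, 0) := fun h => by
        have := congrFun (congrArg Prod.snd h) k
        simp [raise] at this
      rw [lp.single_apply_ne _ _ _ this, map_zero, mul_zero]
  rw [e, finrank_span_eq_card hv]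

lemma HilbertModule.Iso.finrank_jointCokernel_eq {T T' : TreeProduct d} {X : HilbertModule a T}
    {Y : HilbertModule a T'} (h : X.Iso Y) :
    Module.finrank ℂ (jointCokernel X.M) = Module.finrank ℂ (jointCokernel Y.M) := by
  obtain ⟨U, hU⟩ := h
  have e : jointCokernel Y.M = (jointCokernel X.M).map (U.toLinearEquiv : X.H →ₗ[ℂ] Y.H) := by
    ext f
    rw [Submodule.mem_map_equiv, mem_jointCokernel, mem_jointCokernel]
    refine forall_congr' fun k => ?_
    have key : ∀ g, ⟪U.toLinearEquiv.symm f, X.M k g⟫_ℂ = ⟪f, Y.M k (U g)⟫_ℂ := fun g => by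
      rw [← hU, ← U.inner_map_map]
      congr 1
      exact U.apply_symm_apply f
    refine ⟨fun h g => by rw [key, h], fun h g => ?_⟩
    have := key (U.symm g)
    rw [U.apply_symm_apply] at this
    rw [← this, h]
  rw [e]
  exact (LinearEquiv.finrank_map_eq U.toLinearEquiv _).symm

end ModelShift

end DruryArveson
end

/-! ### Depths in trees, the space `E`, and diagonalization of the operator-valued kernel. -/

noncomputable section

namespace DruryArveson

open scoped InnerProductSpace

namespace RootedDirectedTree

variable {T : RootedDirectedTree}

lemma parent_eq {u v : T.V} (h : T.Adj u v) : T.parent v = u := by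
  have hv : v ≠ T.root := fun e => T.not_adj_root u (e ▸ h)
  exact (T.existsUnique_parent v hv).unique (TreeProduct.adj_parent T v hv) h

lemma Adj.ne_root {u v : T.V} (h : T.Adj u v) : v ≠ T.root :=
  fun e => T.not_adj_root u (e ▸ h)

lemma exists_mem_generation (v : T.V) : ∃ n, v ∈ T.generation n := by
  have h := T.reachable v
  induction h with
  | refl => exact ⟨0, rfl⟩
  | tail _ h ih =>
    obtain ⟨n, hn⟩ := ih
    exact ⟨n + 1, _, hn, h⟩

lemma generation_unique {n m : ℕ} {v : T.V} (hn : v ∈ T.generation n) (hm : v ∈ T.generation m) :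
    n = m := by
  induction n generalizing m v with
  | zero =>
    cases m with
    | zero => rfl
    | succ m =>
      obtain ⟨u, -, h⟩ := hm
      exact absurd hn h.ne_root
  | succ n ih =>
    obtain ⟨u, hu, h⟩ := hn
    cases m with
    | zero => exact absurd hm h.ne_root
    | succ m =>
      obtain ⟨u', hu', h'⟩ := hm
      have : u = u' := (parent_eq h).symm.trans (parent_eq h')
      subst this
      rw [ih hu hu']

lemma mem_generation_depth (v : T.V) : v ∈ T.generation (T.depth v) :=
  Nat.sInf_mem (s := {n | v ∈ T.generation n}) (exists_mem_generation v)

lemma depth_root : T.depth T.root = 0 :=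
  generation_unique (mem_generation_depth _) rfl

lemma depth_of_adj {u v : T.V} (h : T.Adj u v) : T.depth v = T.depth u + 1 :=
  generation_unique (mem_generation_depth _) ⟨u, mem_generation_depth u, h⟩

end RootedDirectedTree

open RootedDirectedTree

namespace TreeProduct

variable {d : ℕ} (T : TreeProduct d) {a : ℕ}

lemma mem_childFinset {j : Fin d} {x y : (T.tree j).V} :
    y ∈ T.childFinset j x ↔ (T.tree j).Adj x y := by
  simp [childFinset, children]

lemma par_update {j : Fin d} {v : T.Vert} {η : (T.tree j).V} (h : (T.tree j).Adj (v j) η) :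
    T.par j (Function.update v j η) = v := by
  simp [par, parent_eq h]

lemma update_par {j : Fin d} (w : T.Vert) : Function.update (T.par j w) j (w j) = w := by
  simp [par]

lemma shift_apply (j : Fin d) (f : T.L2) (w : T.Vert) :
    T.shift a j f w = T.shiftFun a j f w := rfl

/-- This is the value at `v` of the adjoint of `T.shift a j` applied to `f`; it turns membership in
`E` into explicit linear equations. -/
lemma inner_shift_single (j : Fin d) (v : T.Vert) (f : T.L2) [DecidableEq T.Vert] :
    ⟪T.shift a j (lp.single 2 v 1), f⟫_ℂ =
      ∑ η ∈ T.childFinset j (v j),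
        f (Function.update v j η) * (T.weight a j (Function.update v j η) : ℂ) := by
  classical
  have hinj : Function.Injective (Function.update v j) := Function.update_injective v j
  have h := lp.hasSum_inner (𝕜 := ℂ) (T.shift a j (lp.single 2 v 1)) f
  rw [← h.tsum_eq, tsum_eq_sum (s := (T.childFinset j (v j)).image (Function.update v j))]
  · rw [Finset.sum_image hinj.injOn]
    refine Finset.sum_congr rfl fun η hη => ?_
    rw [mem_childFinset] at hη
    rw [shift_apply, shiftFun, Function.update_self, if_pos hη.ne_root, T.par_update hη,
      lp.single_apply_self, mul_one, RCLike.inner_apply, Complex.conj_ofReal]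
  · intro w hw
    rw [shift_apply, shiftFun]
    split_ifs with h0
    · rw [lp.single_apply_ne, mul_zero, inner_zero_left]
      intro e
      refine hw (Finset.mem_image.2 ⟨w j, ?_, by rw [← e, update_par]⟩)
      rw [mem_childFinset, ← e]
      simpa [par] using adj_parent _ _ h0
    · rw [inner_zero_left]

lemma mem_E_iff (f : T.L2) : f ∈ T.E a ↔ ∀ (j : Fin d) (v : T.Vert),
    ∑ η ∈ T.childFinset j (v j),
      f (Function.update v j η) * (T.weight a j (Function.update v j η) : ℂ) = 0 := by
  classical
  simp only [E, Submodule.mem_iInf]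
  refine forall_congr' fun j => ?_
  rw [LinearMap.mem_ker]
  constructor
  · intro h v
    rw [← T.inner_shift_single, ← ContinuousLinearMap.adjoint_inner_right]
    have h' : (ContinuousLinearMap.adjoint (T.shift a j)) f = 0 := h
    rw [h', inner_zero_right]
  · intro h
    change (ContinuousLinearMap.adjoint (T.shift a j)) f = 0
    ext v
    have h2 := h v
    rw [← T.inner_shift_single, ← ContinuousLinearMap.adjoint_inner_right,
      lp.inner_single_left] at h2
    simpa using h2

/-- The equations that define `L` are among those that define `E`, taken at `v` with its `j`-th
coordinate replaced by the common parent. Only the support condition is a restriction. -/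
lemma mem_L_of_support {F : Finset (Fin d)} {u : T.Vert} (f : T.E a)
    (hf : ∀ w, w ∉ T.sib F u → (f : T.L2) w = 0) : f ∈ T.L a F u := by
  refine ⟨hf, fun j hj v hv => ?_⟩
  have h := (T.mem_E_iff (f : T.L2)).1 f.2 j
    (Function.update v j ((T.tree j).parent (u j)))
  simpa using h

lemma depth_eq_of_mem_sib {F : Finset (Fin d)} {u v : T.Vert} (hu : u ∈ T.Phi F)
    (h : v ∈ T.sib F u) : T.depth v = T.depth u := by
  funext j
  by_cases hj : j ∈ F
  · have h1 := adj_parent _ _ ((h.1 j).2 hj)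
    have h2 := adj_parent _ _ ((hu j).2 hj)
    rw [h.2 j hj] at h1
    rw [depth, depth, depth_of_adj h1, depth_of_adj h2]
  · have h1 : v j = _ := not_not.1 (mt (h.1 j).1 hj)
    have h2 : u j = _ := not_not.1 (mt (hu j).1 hj)
    rw [depth, depth, h1, h2]

lemma Omega_subset_Phi (F : Finset (Fin d)) : T.Omega F ⊆ T.Phi F := by
  rintro _ ⟨q, rfl⟩
  exact (Quotient.out q).2

lemma eq_of_mem_sib {F : Finset (Fin d)} {u u' : T.Vert} (hu : u ∈ T.Omega F)
    (hu' : u' ∈ T.Omega F) {w : T.Vert} (h : w ∈ T.sib F u) (h' : w ∈ T.sib F u') : u = u' := by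
  obtain ⟨q, rfl⟩ := hu
  obtain ⟨q', rfl⟩ := hu'
  have : q = q' := by
    rw [← Quotient.out_equiv_out (s := T.sibSetoid F)]
    exact ⟨(Quotient.out q).2, fun j hj => (h.2 j hj).symm.trans (h'.2 j hj)⟩
  rw [this]

lemma exists_mem_Omega {F : Finset (Fin d)} {w : T.Vert} (hw : w ∈ T.Phi F) :
    ∃ u ∈ T.Omega F, w ∈ T.sib F u := by
  refine ⟨_, ⟨Quotient.mk (T.sibSetoid F) ⟨w, hw⟩, rfl⟩, ?_⟩
  exact (T.sibSetoid F).symm (Quotient.mk_out (s := T.sibSetoid F) ⟨w, hw⟩)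

lemma Phi_unique {F G : Finset (Fin d)} {w : T.Vert} (hF : w ∈ T.Phi F) (hG : w ∈ T.Phi G) :
    F = G := by
  ext j
  rw [← hF j, ← hG j]

lemma inner_eq_zero_of_disjoint (f g : T.L2) (h : ∀ v, f v = 0 ∨ g v = 0) : ⟪f, g⟫_ℂ = 0 := by
  rw [lp.inner_eq_tsum]
  convert! tsum_zero with v
  rcases h v with h | h <;> simp [h]

section Adapted

variable {F : Finset (Fin d)} {G : Finset (Fin d)} {w : T.Vert} {x : T.E a}

lemma starProjection_eq_self (hx : ∀ v, v ∉ T.sib F w → (x : T.L2) v = 0) {u : T.Vert}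
    (hw : w ∈ T.sib F u) : (T.L a F u).starProjection x = x := by
  rw [Submodule.starProjection_eq_self_iff]
  refine T.mem_L_of_support x fun v hv => hx v fun h => hv ⟨h.1, fun j hj => ?_⟩
  exact (h.2 j hj).trans (hw.2 j hj)

/-- Distinct sibling classes are disjoint, also for different `F` and `G`, so the supports are
disjoint. -/
lemma starProjection_eq_zero (hx : ∀ v, v ∉ T.sib F w → (x : T.L2) v = 0) (hF : w ∈ T.Phi F)
    {u : T.Vert} (hw : w ∉ T.sib G u) : (T.L a G u).starProjection x = 0 := by
  rw [Submodule.starProjection_apply_eq_zero_iff, Submodule.mem_orthogonal]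
  intro g hg
  refine T.inner_eq_zero_of_disjoint _ _ fun v => ?_
  by_cases hv : v ∈ T.sib F w
  · left
    refine hg.1 v fun hv' => hw ?_
    obtain rfl := T.Phi_unique hv.1 hv'.1
    exact ⟨hF, fun j hj => (hv.2 j hj).symm.trans (hv'.2 j hj)⟩
  · exact Or.inr (hx v hv)

end Adapted

/-- On a vector of an orthonormal basis of `E` that is adapted to the classes of siblings, the
kernel acts as a scalar kernel. -/
lemma kernel_apply_basis {ι : Type} [Fintype ι] (b : OrthonormalBasis ι ℂ (T.E a))
    (F : ι → Finset (Fin d)) (w : ι → T.Vert) (hF : ∀ i, w i ∈ T.Phi (F i))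
    (hb : ∀ i v, v ∉ T.sib (F i) (w i) → (b i : T.L2) v = 0) (z z' : UnitBall d) (i : ι) :
    T.kernel a z z' (b i) = scalarKernel a (T.depth (w i)) z z' • b i := by
  classical
  -- Only finitely many classes meet the finite basis, and all other projections vanish on it, hence
  -- are zero. This gives summability in operator norm, without which `∑'` would take its default
  -- value and could not be evaluated at `b i`.
  have hfin : ∀ G, Set.Finite {u : T.Omega G | ∃ i, w i ∈ T.sib G u} := fun G => by
    have : Nonempty ι := ⟨i⟩
    choose! f hf using fun (u : T.Omega G) (hu : ∃ i, w i ∈ T.sib G u) => hu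
    refine Set.Finite.of_injOn (f := f) (t := Set.univ) (fun _ _ => Set.mem_univ _) ?_
      Set.finite_univ
    intro u hu u' hu' e
    have h' := hf u' hu'
    rw [← e] at h'
    exact Subtype.ext (T.eq_of_mem_sib u.2 u'.2 (hf u hu) h')
  have hsum : ∀ G, Summable fun u : T.Omega G =>
      scalarKernel a (T.depth u) z z' • (T.L a G u).starProjection := fun G => by
    refine summable_of_ne_finset_zero (s := (hfin G).toFinset) fun u hu => ?_
    have h0 : ∀ i, w i ∉ T.sib G u := by simpa using hu
    have : (T.L a G u).starProjection = 0 := by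
      refine ContinuousLinearMap.coe_injective (b.toBasis.ext fun i => ?_)
      simpa using T.starProjection_eq_zero (hb i) (hF i) (h0 i)
    rw [this, smul_zero]
  have happ : ∀ G, (∑' u : T.Omega G,
      scalarKernel a (T.depth u) z z' • (T.L a G u).starProjection) (b i) =
      ∑' u : T.Omega G, scalarKernel a (T.depth u) z z' • (T.L a G u).starProjection (b i) :=
    fun G => (ContinuousLinearMap.apply ℂ (T.E a) (b i)).map_tsum (hsum G)
  obtain ⟨u, hu, hwu⟩ := T.exists_mem_Omega (hF i)
  simp only [kernel, Matrix.of_apply, sum_apply, happ]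
  rw [Finset.sum_eq_single (F i), tsum_eq_single ⟨u, hu⟩,
    T.starProjection_eq_self (hb i) hwu,
    T.depth_eq_of_mem_sib (T.Omega_subset_Phi _ hu) hwu]
  · intro u' hu'
    rw [T.starProjection_eq_zero (hb i) (hF i), smul_zero]
    exact fun h => hu' (Subtype.ext (T.eq_of_mem_sib u'.2 hu h hwu))
  · intro G _ hG
    convert! tsum_zero with u'
    rw [T.starProjection_eq_zero (hb i) (hF i), smul_zero]
    exact fun h => hG (T.Phi_unique h.1 (hF i))
  · simp

end TreeProduct

/-- The Hilbert module of a product of trees with an adapted orthonormal basis of `E`, realized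
on the model space. -/
def modelModule {d a : ℕ} (ha : 0 < a) (T : TreeProduct d) {ι : Type} [Fintype ι]
    (δ : ι → Fin d → ℕ) (b : OrthonormalBasis ι ℂ (T.E a))
    (h : ∀ z z' i, T.kernel a z z' (b i) = scalarKernel a (δ i) z z' • b i) :
    HilbertModule a T :=
  letI := modelRKHS ha δ b
  { H := ModelSpace ι d
    kernel_eq := by
      funext z z'
      refine ContinuousLinearMap.coe_injective (b.toBasis.ext fun i => ?_)
      simp only [ContinuousLinearMap.coe_coe, OrthonormalBasis.coe_toBasis]
      rw [h, kernel_model_apply]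
    M := modelShift ha δ
    M_apply := fun k f z => modelEval_modelShift ha δ b k f z }

end DruryArveson
end

/-! ### An adapted basis of `E` when all factors but one are paths. -/

noncomputable section

namespace DruryArveson

open scoped InnerProductSpace Classical

open RootedDirectedTree

namespace TreeProduct

variable {d : ℕ} (T : TreeProduct d) {a : ℕ}

/-- All children of `v` in the direction `j` carry the same nonzero weight, which factors out of the
sum. -/
lemma mem_E_iff_sum_eq_zero (ha : 0 < a) (f : T.L2) : f ∈ T.E a ↔ ∀ (j : Fin d) (v : T.Vert),
    ∑ η ∈ T.childFinset j (v j), f (Function.update v j η) = 0 := by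
  rw [mem_E_iff]
  refine forall_congr' fun j => forall_congr' fun v => ?_
  have hd : 0 < d := Fin.pos j
  set c : ℝ := √(cSeq d a (∑ i, T.depth v i) / (T.childFinset j (v j)).card) *
    √(((T.depth v j : ℝ) + 1) / ((∑ i, T.depth v i : ℕ) + d)) with hc
  have hcard : 0 < (T.childFinset j (v j)).card := by
    obtain ⟨y, hy⟩ := T.leafless j (v j)
    exact Finset.card_pos.2 ⟨y, T.mem_childFinset.2 hy⟩
  have hc0 : (c : ℂ) ≠ 0 := by
    have : 0 < cSeq d a (∑ i, T.depth v i) := by unfold cSeq; positivity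
    have : 0 < c := by positivity
    exact_mod_cast this.ne'
  rw [Finset.sum_congr rfl (g := fun η => f (Function.update v j η) * (c : ℂ)) fun η hη => by
    rw [weight, T.par_update (T.mem_childFinset.1 hη)], ← Finset.sum_mul]
  simp [hc0]

variable (j₀ : Fin d)

/-- The vertex with coordinate `y` in the direction `j₀` and the roots as other coordinates. -/
def axisVert (y : (T.tree j₀).V) : T.Vert := Function.update (fun j => (T.tree j).root) j₀ y

lemma axisVert_self (y : (T.tree j₀).V) : T.axisVert j₀ y j₀ = y := by simp [axisVert]

lemma axisVert_ne (y : (T.tree j₀).V) {j : Fin d} (hj : j ≠ j₀) :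
    T.axisVert j₀ y j = (T.tree j).root := by simp [axisVert, hj]

lemma axisVert_injective : Function.Injective (T.axisVert j₀) := fun y y' h => by
  simpa [axisVert] using congrFun h j₀

lemma depth_axisVert (y : (T.tree j₀).V) :
    T.depth (T.axisVert j₀ y) = Pi.single j₀ ((T.tree j₀).depth y) := by
  funext j
  by_cases hj : j = j₀
  · subst hj; simp [depth, axisVert_self]
  · simp [depth, T.axisVert_ne j₀ y hj, hj, depth_root]

/-- A function on the children of a vertex of the factor `j₀`, as an element of `l²(V)`. -/
def axisExt (v : (T.tree j₀).V) (h : EuclideanSpace ℂ (T.childFinset j₀ v)) : T.L2 :=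
  ∑ y : T.childFinset j₀ v, h y • lp.single 2 (T.axisVert j₀ y) 1

/-- The restriction of an element of `l²(V)` to the children of a vertex of the factor `j₀`. -/
def axisRes (v : (T.tree j₀).V) (f : T.L2) : EuclideanSpace ℂ (T.childFinset j₀ v) :=
  WithLp.toLp 2 fun y => f (T.axisVert j₀ y)

lemma axisExt_apply (v : (T.tree j₀).V) (h : EuclideanSpace ℂ (T.childFinset j₀ v)) (w : T.Vert) :
    T.axisExt j₀ v h w = ∑ y : T.childFinset j₀ v, if w = T.axisVert j₀ y then h y else 0 := by
  simp only [axisExt, lp.coeFn_sum, Finset.sum_apply, lp.coeFn_smul, Pi.smul_apply]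
  refine Finset.sum_congr rfl fun y _ => ?_
  split_ifs with hw
  · rw [hw, lp.single_apply_self, smul_eq_mul, mul_one]
  · rw [lp.single_apply_ne _ _ _ hw, smul_zero]

lemma axisExt_eq_zero (v : (T.tree j₀).V) (h : EuclideanSpace ℂ (T.childFinset j₀ v)) {w : T.Vert}
    (hw : ∀ y, (T.tree j₀).Adj v y → w ≠ T.axisVert j₀ y) : T.axisExt j₀ v h w = 0 := by
  rw [axisExt_apply]
  exact Finset.sum_eq_zero fun y _ => if_neg (hw y (T.mem_childFinset.1 y.2))

lemma inner_axisExt (v : (T.tree j₀).V) (h : EuclideanSpace ℂ (T.childFinset j₀ v)) (f : T.L2) :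
    ⟪T.axisExt j₀ v h, f⟫_ℂ = ⟪h, T.axisRes j₀ v f⟫_ℂ := by
  simp [axisExt, axisRes, lp.inner_single_left, PiLp.inner_apply,
    mul_comm]

lemma axisRes_axisExt (v : (T.tree j₀).V) (h : EuclideanSpace ℂ (T.childFinset j₀ v)) :
    T.axisRes j₀ v (T.axisExt j₀ v h) = h := by
  ext y
  rw [axisRes, PiLp.toLp_apply, axisExt_apply, Finset.sum_eq_single y]
  · simp
  · intro y' _ hy'
    rw [if_neg fun e => hy' (Subtype.ext (T.axisVert_injective j₀ e)).symm]
  · simp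

/-- The sum of the values, as a functional. -/
def sumFunctional (v : (T.tree j₀).V) : Module.Dual ℂ (EuclideanSpace ℂ (T.childFinset j₀ v)) where
  toFun h := ∑ y, h y
  map_add' h h' := by simp [Finset.sum_add_distrib]
  map_smul' c h := by simp [Finset.mul_sum]

lemma finrank_ker_sumFunctional (v : (T.tree j₀).V) :
    Module.finrank ℂ (T.sumFunctional j₀ v).ker + 1 = (T.childFinset j₀ v).card := by
  rw [Module.Dual.finrank_ker_add_one_of_ne_zero]
  · simp
  · obtain ⟨y, hy⟩ := T.leafless j₀ v
    intro h
    have := congrArg (fun φ => φ (EuclideanSpace.single (⟨y, T.mem_childFinset.2 hy⟩ :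
      T.childFinset j₀ v) (1 : ℂ))) h
    simp [sumFunctional] at this

lemma axisExt_mem_E (ha : 0 < a) (v : (T.tree j₀).V) (h : (T.sumFunctional j₀ v).ker) :
    T.axisExt j₀ v h ∈ T.E a := by
  rw [T.mem_E_iff_sum_eq_zero ha]
  intro j u
  by_cases hj : j = j₀
  · subst hj
    by_cases hu : u = T.axisVert j v
    · subst hu
      rw [axisVert_self, ← Finset.sum_coe_sort]
      have h0 : ∑ y, (h : EuclideanSpace ℂ (T.childFinset j v)) y = 0 := h.2
      rw [← h0]
      refine Finset.sum_congr rfl fun y _ => ?_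
      have e : Function.update (T.axisVert j v) j (y : (T.tree j).V) = T.axisVert j y := by
        simp [axisVert]
      rw [e]
      exact congrArg (fun g : EuclideanSpace ℂ _ => g y) (T.axisRes_axisExt j v h)
    · refine Finset.sum_eq_zero fun η hη => T.axisExt_eq_zero j v h fun y hy e => hu ?_
      have h1 : η = y := by simpa [axisVert] using congrFun e j
      subst h1
      have h2 := T.par_update (T.mem_childFinset.1 hη)
      rw [← h2, e]
      simp [par, axisVert, parent_eq hy]
  · refine Finset.sum_eq_zero fun η hη => T.axisExt_eq_zero j₀ v h fun y _ e => ?_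
    have h1 := congrFun e j
    rw [Function.update_self, T.axisVert_ne j₀ y hj] at h1
    exact (T.mem_childFinset.1 hη).ne_root h1

lemma axisRes_mem_ker (ha : 0 < a) (v : (T.tree j₀).V) (f : T.E a) :
    T.axisRes j₀ v f ∈ (T.sumFunctional j₀ v).ker := by
  have h := (T.mem_E_iff_sum_eq_zero ha (f : T.L2)).1 f.2 j₀ (T.axisVert j₀ v)
  rw [axisVert_self, ← Finset.sum_coe_sort] at h
  rw [LinearMap.mem_ker]
  simpa [sumFunctional, axisRes, axisVert] using h

lemma single_root_mem_E (ha : 0 < a) :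
    (lp.single 2 (T.axisVert j₀ (T.tree j₀).root) 1 : T.L2) ∈ T.E a := by
  rw [T.mem_E_iff_sum_eq_zero ha]
  intro j u
  refine Finset.sum_eq_zero fun η hη => lp.single_apply_ne _ _ _ fun e => ?_
  have h1 := congrFun e j
  rw [Function.update_self] at h1
  refine (T.mem_childFinset.1 hη).ne_root (h1.trans ?_)
  by_cases hj : j = j₀
  · subst hj; rw [axisVert_self]
  · rw [T.axisVert_ne j₀ _ hj]

/-- Along a path the zero-sum condition has a single term. -/
lemma apply_eq_zero_of_path (ha : 0 < a) {j : Fin d} (hj : ∀ x, (T.childFinset j x).card = 1)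
    (f : T.E a) {w : T.Vert} (hw : w j ≠ (T.tree j).root) : (f : T.L2) w = 0 := by
  have h := (T.mem_E_iff_sum_eq_zero ha (f : T.L2)).1 f.2 j (T.par j w)
  have hm : w j ∈ T.childFinset j (T.par j w j) := by
    rw [mem_childFinset]
    simpa [par] using adj_parent _ _ hw
  obtain ⟨y, hy⟩ := Finset.card_eq_one.1 (hj (T.par j w j))
  rw [hy] at h hm
  rw [Finset.mem_singleton] at hm
  rwa [Finset.sum_singleton, ← hm, update_par] at h

section Basis

-- The fibre of `p` over `v` has as many elements as the dimension of the zero-sum functions on the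
-- children of `v`. So `X` indexes bases of all these spaces at once, and its finiteness expresses
-- that branching is finite.
variable {X : Type} [Fintype X] (p : X → (T.tree j₀).V)
  (hp : ∀ v, (T.childFinset j₀ v).card = Nat.card {x // p x = v} + 1)

/-- An orthonormal basis of the functions with sum zero on the children of a vertex. -/
def sumZeroBasis (v : (T.tree j₀).V) :
    OrthonormalBasis {x // p x = v} ℂ (T.sumFunctional j₀ v).ker :=
  (stdOrthonormalBasis ℂ (T.sumFunctional j₀ v).ker).reindex <| Fintype.equivOfCardEq <| by
    have h1 := T.finrank_ker_sumFunctional j₀ v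
    rw [hp, Nat.card_eq_fintype_card] at h1
    rw [Fintype.card_fin]
    omega

/-- The vectors of an orthonormal basis of `E`. -/
def adaptedVec (ha : 0 < a) : Option X → T.E a
  | none => ⟨_, T.single_root_mem_E j₀ ha⟩
  | some x => ⟨_, T.axisExt_mem_E j₀ ha (p x) (T.sumZeroBasis j₀ p hp (p x) ⟨x, rfl⟩)⟩

lemma adaptedVec_some (ha : 0 < a) (v : (T.tree j₀).V) (x : {x // p x = v}) :
    (T.adaptedVec j₀ p hp ha (some x) : T.L2) =
      T.axisExt j₀ v (T.sumZeroBasis j₀ p hp v x) := by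
  obtain ⟨x, rfl⟩ := x
  rfl

lemma orthonormal_adaptedVec (ha : 0 < a) : Orthonormal ℂ (T.adaptedVec j₀ p hp ha) := by
  have hroot : ∀ v y, (T.tree j₀).Adj v y →
      T.axisVert j₀ (T.tree j₀).root ≠ T.axisVert j₀ y := fun v y h e =>
    h.ne_root (T.axisVert_injective j₀ e).symm
  have h0 : ∀ x, ⟪(T.adaptedVec j₀ p hp ha none : T.L2), T.adaptedVec j₀ p hp ha (some x)⟫_ℂ
      = 0 := fun x => by
    change ⟪(lp.single 2 (T.axisVert j₀ (T.tree j₀).root) 1 : T.L2), T.axisExt j₀ _ _⟫_ℂ = 0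
    rw [lp.inner_single_left, axisExt_eq_zero T j₀ _ _ (hroot _), inner_zero_right]
  rw [orthonormal_iff_ite]
  rintro (_ | x) (_ | y)
  · change ⟪(lp.single 2 (T.axisVert j₀ (T.tree j₀).root) 1 : T.L2), lp.single 2 _ 1⟫_ℂ = _
    rw [lp.inner_single_left, lp.single_apply_self]
    simp
  · simpa using h0 y
  · simpa using inner_eq_zero_symm.1 (h0 x)
  · change ⟪(T.adaptedVec j₀ p hp ha (some x) : T.L2), T.adaptedVec j₀ p hp ha (some y)⟫_ℂ = _
    by_cases h : p x = p y
    · rw [T.adaptedVec_some j₀ p hp ha (p y) ⟨x, h⟩, T.adaptedVec_some j₀ p hp ha (p y) ⟨y, rfl⟩,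
        inner_axisExt, axisRes_axisExt, ← Submodule.coe_inner, OrthonormalBasis.inner_eq_ite]
      simp
    · rw [if_neg fun e => h (congrArg p (Option.some.inj e))]
      -- Children of different vertices are different, as parents are unique.
      refine T.inner_eq_zero_of_disjoint _ _ fun w => ?_
      by_cases hw : ∃ y', (T.tree j₀).Adj (p x) y' ∧ w = T.axisVert j₀ y'
      · right
        obtain ⟨y', hy', rfl⟩ := hw
        refine T.axisExt_eq_zero j₀ _ _ fun z hz e => h ?_
        obtain rfl := T.axisVert_injective j₀ e
        rw [← parent_eq hy', parent_eq hz]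
      · push Not at hw
        exact Or.inl (T.axisExt_eq_zero j₀ _ _ hw)

/-- An orthonormal basis of `E`, if all factors except for the factor `j₀` are paths. -/
def adaptedBasis (ha : 0 < a) (hpath : ∀ j, j ≠ j₀ → ∀ x, (T.childFinset j x).card = 1) :
    OrthonormalBasis (Option X) ℂ (T.E a) :=
  OrthonormalBasis.mkOfOrthogonalEqBot (T.orthonormal_adaptedVec j₀ p hp ha) <| by
    rw [Submodule.eq_bot_iff]
    intro f hf
    have hf' : ∀ i, ⟪(T.adaptedVec j₀ p hp ha i : T.L2), (f : T.L2)⟫_ℂ = 0 := fun i =>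
      (Submodule.mem_orthogonal _ _).1 hf _ (Submodule.subset_span ⟨i, rfl⟩)
    -- The restriction of `f ∈ E` to the children of `v` has sum zero and is orthogonal to a basis
    -- of the zero-sum functions.
    have hres : ∀ v, T.axisRes j₀ v f = 0 := fun v => by
      have : (⟨_, T.axisRes_mem_ker j₀ ha v f⟩ : (T.sumFunctional j₀ v).ker) = 0 := by
        refine (T.sumZeroBasis j₀ p hp v).repr.injective ?_
        ext x
        have h := hf' (some x)
        rw [T.adaptedVec_some j₀ p hp ha v x, inner_axisExt] at h
        rw [OrthonormalBasis.repr_apply_apply]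
        simpa using h
      exact congrArg Subtype.val this
    refine Subtype.ext (lp.ext (funext fun w => ?_))
    by_cases hw : ∃ j, j ≠ j₀ ∧ w j ≠ (T.tree j).root
    · obtain ⟨j, hj, hw⟩ := hw
      exact T.apply_eq_zero_of_path ha (hpath j hj) f hw
    · push Not at hw
      have e : w = T.axisVert j₀ (w j₀) := funext fun j => by
        by_cases hj : j = j₀
        · subst hj; rw [axisVert_self]
        · rw [hw j hj, T.axisVert_ne j₀ _ hj]
      by_cases h0 : w j₀ = (T.tree j₀).root
      · have h := hf' none
        change ⟪(lp.single 2 (T.axisVert j₀ (T.tree j₀).root) 1 : T.L2), (f : T.L2)⟫_ℂ = 0 at h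
        rw [lp.inner_single_left, ← h0, ← e] at h
        simpa using h
      · have h := hres ((T.tree j₀).parent (w j₀))
        have h1 := congrArg (fun g : EuclideanSpace ℂ _ => g ⟨w j₀,
          T.mem_childFinset.2 (adj_parent _ _ h0)⟩) h
        rw [e]
        simpa [axisRes] using h1

/-- The degrees of the vectors of the orthonormal basis of `E`. -/
def adaptedDegree (n : X → ℕ) : Option X → Fin d → ℕ
  | none => 0
  -- The vector lives on the children of `p x`, one generation below `p x`.
  | some x => Pi.single j₀ (n x + 1)

lemma kernel_adaptedBasis (ha : 0 < a)
    (hpath : ∀ j, j ≠ j₀ → ∀ x, (T.childFinset j x).card = 1) (z z' : UnitBall d)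
    (i : Option X) :
    T.kernel a z z' (T.adaptedBasis j₀ p hp ha hpath i) =
      scalarKernel a (adaptedDegree j₀ (fun x => (T.tree j₀).depth (p x)) i) z z' •
        T.adaptedBasis j₀ p hp ha hpath i := by
  have hb : ∀ i, T.adaptedBasis j₀ p hp ha hpath i = T.adaptedVec j₀ p hp ha i := fun i => by
    simp [adaptedBasis]
  -- Any child `c x` of `p x` can represent the sibling class that supports the vector.
  choose c hc using fun x => T.leafless j₀ (p x)
  have hc : ∀ x, (T.tree j₀).Adj (p x) (c x) := hc
  let F : Option X → Finset (Fin d) := fun i => i.elim ∅ fun _ => {j₀}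
  let w : Option X → T.Vert := fun i =>
    i.elim (T.axisVert j₀ (T.tree j₀).root) fun x => T.axisVert j₀ (c x)
  have hchild : ∀ v y, (T.tree j₀).Adj v y → T.axisVert j₀ y ∈ T.Phi {j₀} := fun v y h j => by
    by_cases hj : j = j₀
    · subst hj; simpa [axisVert_self] using h.ne_root
    · simpa [hj] using T.axisVert_ne j₀ y hj
  have hroot : T.axisVert j₀ (T.tree j₀).root ∈ T.Phi ∅ := fun j => by
    by_cases hj : j = j₀
    · subst hj; simp [axisVert_self]
    · simpa using T.axisVert_ne j₀ _ hj
  have hF : ∀ i, w i ∈ T.Phi (F i) := by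
    rintro (_ | x)
    · exact hroot
    · exact hchild _ _ (hc x)
  rw [T.kernel_apply_basis (T.adaptedBasis j₀ p hp ha hpath) F w hF]
  · congr 2
    rcases i with _ | x
    · simp [w, adaptedDegree, depth_axisVert, depth_root]
    · simp [w, adaptedDegree, depth_axisVert, depth_of_adj (hc x)]
  · rintro (_ | x) v hv
    · rw [hb]
      refine lp.single_apply_ne _ _ _ fun e => hv ?_
      rw [e]
      exact ⟨hroot, fun j hj => rfl⟩
    · rw [hb]
      refine T.axisExt_eq_zero j₀ _ _ fun y hy e => hv ?_
      rw [e]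
      refine ⟨hchild _ _ hy, fun j hj => ?_⟩
      obtain rfl := Finset.mem_singleton.1 hj
      simp only [w, Option.elim_some, axisVert_self]
      rw [parent_eq hy, parent_eq (hc x)]

end Basis

/-- The Hilbert module of a product in which all factors except for one are paths. -/
def axisModule (ha : 0 < a) {X : Type} [Fintype X] (n : X → ℕ) (p : X → (T.tree j₀).V)
    (hp : ∀ v, (T.childFinset j₀ v).card = Nat.card {x // p x = v} + 1)
    (hpath : ∀ j, j ≠ j₀ → ∀ x, (T.childFinset j x).card = 1)
    (hn : ∀ x, (T.tree j₀).depth (p x) = n x) : HilbertModule a T :=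
  modelModule ha T (adaptedDegree j₀ n) (T.adaptedBasis j₀ p hp ha hpath) <| by
    obtain rfl : (fun x => (T.tree j₀).depth (p x)) = n := funext hn
    exact T.kernel_adaptedBasis j₀ p hp ha hpath

end TreeProduct

/-- The space and the operators of `axisModule` are built from `X` and `n` alone. Since `n` is a
parameter tied to the tree only by an equation, both modules have definitionally the same operators
and the identity intertwines them. -/
lemma iso_axisModule {d a : ℕ} (ha : 0 < a) (j₀ : Fin d) {X : Type} [Fintype X] (n : X → ℕ)
    {T T' : TreeProduct d} (p : X → (T.tree j₀).V) (p' : X → (T'.tree j₀).V) (hp hp' hpath hpath'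
    hn hn') : (T.axisModule j₀ ha n p hp hpath hn).Iso (T'.axisModule j₀ ha n p' hp' hpath' hn') :=
  ⟨LinearIsometryEquiv.refl ℂ (ModelSpace (Option X) d), fun _ _ => rfl⟩

lemma finrank_axisModule {d a : ℕ} (ha : 0 < a) (j₀ : Fin d) {X : Type} [Fintype X] (n : X → ℕ)
    {T : TreeProduct d} (p : X → (T.tree j₀).V) (hp hpath hn) :
    Module.finrank ℂ (jointCokernel (T.axisModule j₀ ha n p hp hpath hn).M) =
      Fintype.card X + 1 :=
  (finrank_jointCokernel_modelShift ha (TreeProduct.adaptedDegree j₀ n)).trans (Fintype.card_option)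

end DruryArveson
end

/-! ### Bushes, their products with paths, and numbers of children as graph invariants. -/

noncomputable section

namespace DruryArveson

open RootedDirectedTree

/-- The rooted directed tree without branching. -/
def pathTree : RootedDirectedTree where
  V := ℕ
  Adj u v := v = u + 1
  root := 0
  not_adj_root u h := by omega
  existsUnique_parent v hv := ⟨v - 1, by dsimp only; omega, fun u hu => by dsimp only at hu; omega⟩
  reachable v := by
    induction v with
    | zero => exact .refl
    | succ v ih => exact ih.tail rfl

section Bush

variable {X : Type} (c : X → Bool)

/-- The vertices of a tree with branching at the root and at its two children. -/
inductive BushVert : Type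
  | root : BushVert
  | mid (t : Bool) : BushVert
  -- The value `none` supplies a ray even when the fibre over `t` is empty, so that there is no
  -- leaf.
  | ray (t : Bool) (x : Option {x // c x = t}) (n : ℕ) : BushVert

/-- The edges of a tree with branching at the root and at its two children. -/
inductive BushAdj : BushVert c → BushVert c → Prop
  | root_mid (t : Bool) : BushAdj .root (.mid t)
  | mid_ray (t : Bool) (x : Option {x // c x = t}) : BushAdj (.mid t) (.ray t x 0)
  | ray_ray (t : Bool) (x : Option {x // c x = t}) (n : ℕ) :
      BushAdj (.ray t x n) (.ray t x (n + 1))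

/-- A tree whose root has two children `t`, the number of children of each of which is
`1 + card {x // c x = t}`, and which has no further branching. -/
def bush : RootedDirectedTree where
  V := BushVert c
  Adj := BushAdj c
  root := .root
  not_adj_root u h := by cases h
  existsUnique_parent v hv := by
    rcases v with _ | t | ⟨t, x, _ | n⟩
    · exact absurd rfl hv
    · exact ⟨.root, .root_mid t, fun u h => by cases h; rfl⟩
    · exact ⟨.mid t, .mid_ray t x, fun u h => by cases h; rfl⟩
    · exact ⟨.ray t x n, .ray_ray t x n, fun u h => by cases h; rfl⟩
  reachable v := by
    have h1 : ∀ t, Relation.ReflTransGen (BushAdj c) .root (.mid t) := fun t => .single (.root_mid t)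
    rcases v with _ | t | ⟨t, x, n⟩
    · exact .refl
    · exact h1 t
    · induction n with
      | zero => exact (h1 t).tail (.mid_ray t x)
      | succ n ih => exact ih.tail (.ray_ray t x n)

lemma children_root : (bush c).children BushVert.root = Set.range BushVert.mid := by
  ext v
  constructor
  · intro h
    obtain ⟨t⟩ : BushAdj c .root v := h
    exact ⟨t, rfl⟩
  · rintro ⟨t, rfl⟩
    exact .root_mid t

lemma children_mid (t : Bool) :
    (bush c).children (BushVert.mid t) = Set.range fun x => BushVert.ray t x 0 := by
  ext v
  constructor
  · intro h
    obtain _ | ⟨_, x⟩ : BushAdj c (.mid t) v := h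
    exact ⟨x, rfl⟩
  · rintro ⟨x, rfl⟩
    exact .mid_ray t x

lemma children_ray (t : Bool) (x : Option {x // c x = t}) (n : ℕ) :
    (bush c).children (BushVert.ray t x n) = {BushVert.ray t x (n + 1)} := by
  ext v
  constructor
  · intro h
    cases (h : BushAdj c (.ray t x n) v)
    rfl
  · rintro rfl
    exact .ray_ray t x n

/-- The assignment of basis vectors to the branching vertices. -/
def bushVertOf : Option X → (bush c).V
  | none => BushVert.root
  | some x => BushVert.mid (c x)

/-- The depths of the branching vertices that correspond to the basis vectors. -/
def bushDepth : Option X → ℕ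
  | none => 0
  | some _ => 1

lemma depth_bushVertOf (x : Option X) : (bush c).depth (bushVertOf c x) = bushDepth x := by
  have h0 : (bush c).depth BushVert.root = 0 := depth_root
  rcases x with _ | x
  · exact h0
  · have h : (bush c).Adj BushVert.root (BushVert.mid (c x)) := BushAdj.root_mid _
    exact (depth_of_adj h).trans (by rw [h0]; rfl)

lemma ncard_children_root : ((bush c).children BushVert.root).ncard = 2 := by
  refine (congrArg Set.ncard (children_root c)).trans ?_
  change (Set.range (BushVert.mid : Bool → BushVert c)).ncard = 2
  rw [← Set.image_univ, Set.ncard_image_of_injective _ fun t t' h => by cases h; rfl]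
  simp

lemma ncard_children_mid [Finite X] (t : Bool) :
    ((bush c).children (BushVert.mid t)).ncard = Nat.card {x // c x = t} + 1 := by
  refine (congrArg Set.ncard (children_mid c t)).trans ?_
  change (Set.range fun x => (BushVert.ray t x 0 : BushVert c)).ncard = _
  rw [← Set.image_univ, Set.ncard_image_of_injective _ fun t t' h => by cases h; rfl,
    Set.ncard_univ, Finite.card_option]

lemma ncard_children_ray (t : Bool) (x : Option {x // c x = t}) (n : ℕ) :
    ((bush c).children (BushVert.ray t x n)).ncard = 1 :=
  (congrArg Set.ncard (children_ray c t x n)).trans (Set.ncard_singleton _)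

/-- This is the counting hypothesis of the adapted basis, with index type `Option X`: `none`
accounts for the second child of the root, and each `some x` for one extra child of `mid (c x)`. -/
lemma ncard_children_bush [Finite X] (v : (bush c).V) :
    ((bush c).children v).ncard = Nat.card {x // bushVertOf c x = v} + 1 := by
  rcases v with _ | t | ⟨t, x, n⟩
  · refine (ncard_children_root c).trans ?_
    have : {x | bushVertOf c x = BushVert.root} = {none} := by
      ext x
      rcases x with _ | x
      · exact iff_of_true rfl rfl
      · exact iff_of_false (fun h => by cases h) (fun h => by cases h)
    change _ = Nat.card {x | bushVertOf c x = BushVert.root} + 1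
    rw [this]
    simp
  · refine (ncard_children_mid c t).trans ?_
    congr 1
    refine Nat.card_congr (Equiv.ofBijective
      (fun x => ⟨some x.1, congrArg BushVert.mid x.2⟩) ⟨fun x y h => ?_, ?_⟩)
    · simpa [Subtype.ext_iff] using h
    · rintro ⟨_ | x, hx⟩
      · cases hx
      · have hx' : BushVert.mid (c := c) (c x) = .mid t := hx
        exact ⟨⟨x, BushVert.mid.inj hx'⟩, rfl⟩
  · refine (ncard_children_ray c t x n).trans ?_
    have : IsEmpty {y // bushVertOf c y = BushVert.ray t x n} := by
      refine ⟨?_⟩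
      rintro ⟨_ | y, hy⟩ <;> cases hy
    rw [Nat.card_of_isEmpty]

lemma countable_bush [Finite X] : Countable (bush c).V := by
  let f : (bush c).V → Option (Bool × ℕ) ⊕ (Σ t, Option {x // c x = t} × ℕ) := fun v =>
    BushVert.casesOn v (.inl none) (fun t => .inl (some (t, 0))) fun t x n => .inr ⟨t, x, n⟩
  refine Function.Injective.countable (f := f) ?_
  rintro (_ | t | ⟨t, x, n⟩) (_ | t' | ⟨t', x', n'⟩) h <;> simp [f] at h
  · rfl
  · rw [h]
  · obtain ⟨rfl, h⟩ := h
    simp only [heq_eq_eq, Prod.mk.injEq] at h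
    rw [h.1, h.2]

lemma infinite_bush : Infinite (bush c).V :=
  Infinite.of_injective (fun n => (BushVert.ray true none n : BushVert c)) fun n m h => by
    cases h; rfl

lemma finite_children_bush [Finite X] (v : (bush c).V) : ((bush c).children v).Finite :=
  Set.finite_of_ncard_ne_zero (by rw [ncard_children_bush]; omega)

lemma nonempty_children_bush [Finite X] (v : (bush c).V) : ((bush c).children v).Nonempty :=
  Set.nonempty_of_ncard_ne_zero (by rw [ncard_children_bush]; omega)

lemma branchingIndex_bush_lt_top : (bush c).branchingIndex < ⊤ := by
  refine lt_of_le_of_lt (b := (2 : ℕ∞)) (iSup₂_le fun v hv => ?_) (by decide)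
  have h0 : (bush c).depth BushVert.root = 0 := depth_root
  rcases v with _ | t | ⟨t, x, n⟩
  · rw [h0]; norm_num
  · have h : (bush c).Adj BushVert.root (BushVert.mid t) := BushAdj.root_mid _
    rw [depth_of_adj h, h0]; norm_num
  · have h : ((bush c).children (BushVert.ray t x n)).Nontrivial := hv
    rw [children_ray] at h
    exact absurd h Set.not_nontrivial_singleton

end Bush

/-- The product of a tree with branching at the root and at its two children, and of paths. -/
def bushProduct {d : ℕ} (j₀ : Fin d) {X : Type} [Finite X] (c : X → Bool) : TreeProduct d where
  tree j := if j = j₀ then bush c else pathTree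
  countable j := by
    split_ifs
    · exact countable_bush c
    · exact inferInstanceAs (Countable ℕ)
  infinite j := by
    split_ifs
    · exact infinite_bush c
    · exact inferInstanceAs (Infinite ℕ)
  leafless j := by
    by_cases h : j = j₀
    · rw [if_pos h]
      exact nonempty_children_bush c
    · rw [if_neg h]
      exact fun v => Set.singleton_nonempty _
  locallyFinite j := by
    by_cases h : j = j₀
    · rw [if_pos h]
      exact finite_children_bush c
    · rw [if_neg h]
      exact fun v => Set.finite_singleton _
  finite_branchingIndex j := by
    split_ifs
    · exact branchingIndex_bush_lt_top c
    · refine lt_of_le_of_lt (b := (0 : ℕ∞)) (iSup₂_le fun v hv => ?_) (by decide)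
      exact absurd hv Set.not_nontrivial_singleton

namespace TreeProduct

variable {d : ℕ} (T : TreeProduct d)

lemma card_childFinset (j : Fin d) (x : (T.tree j).V) :
    (T.childFinset j x).card = ((T.tree j).children x).ncard :=
  (Set.ncard_eq_toFinset_card _ _).symm

/-- The number of the children of a vertex of the product. -/
lemma ncard_adj (v : T.Vert) :
    {w | T.Adj v w}.ncard = ∑ j, ((T.tree j).children (v j)).ncard := by
  classical
  let f : (Σ j, (T.tree j).V) → T.Vert := fun y => Function.update v y.1 y.2
  let s : Finset (Σ j, (T.tree j).V) := Finset.univ.sigma fun j => T.childFinset j (v j)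
  have hs : ∀ y ∈ s, (T.tree y.1).Adj (v y.1) y.2 := fun y hy =>
    T.mem_childFinset.1 (Finset.mem_sigma.1 hy).2
  -- A child differs from its parent, so changes in different directions give different vertices.
  have hne : ∀ y ∈ s, y.2 ≠ v y.1 := fun y hy h => by
    have := depth_of_adj (hs y hy)
    rw [h] at this
    omega
  have e : {w | T.Adj v w} = f '' s := by
    ext w
    constructor
    · rintro ⟨k, h1, h2⟩
      refine ⟨⟨k, w k⟩, by simpa [s, mem_childFinset] using h2, funext fun j => ?_⟩
      by_cases hj : j = k
      · subst hj; simp [f]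
      · simp [f, hj, h1 j hj]
    · rintro ⟨⟨k, y⟩, hy, rfl⟩
      exact ⟨k, fun j hj => by simp [f, hj], by simpa [f] using hs _ hy⟩
  have hinj : Set.InjOn f s := by
    rintro ⟨j, x⟩ hx ⟨k, y⟩ hy h
    have hjk : j = k := by
      by_contra hjk
      have : Function.update v j x j = Function.update v k y j := congrFun h j
      rw [Function.update_self, Function.update_of_ne hjk] at this
      exact hne _ hx this
    subst hjk
    have : Function.update v j x j = Function.update v j y j := congrFun h j
    rw [Function.update_self, Function.update_self] at this
    rw [this]
  rw [e, Set.InjOn.ncard_image hinj, Set.ncard_coe_finset, Finset.card_sigma]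
  simp only [card_childFinset]

lemma GraphIso.exists_ncard_eq {T T' : TreeProduct d} (h : T.GraphIso T') (v : T.Vert) :
    ∃ v' : T'.Vert, {w | T'.Adj v' w}.ncard = {w | T.Adj v w}.ncard := by
  obtain ⟨φ⟩ := h
  refine ⟨φ v, ?_⟩
  rw [← Set.ncard_image_of_injective _ φ.injective]
  congr 1
  ext w
  constructor
  · intro hw
    refine ⟨φ.symm w, ?_, φ.apply_symm_apply w⟩
    have : T'.Adj (φ v) (φ (φ.symm w)) := by rwa [φ.apply_symm_apply]
    exact φ.map_rel_iff.1 this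
  · rintro ⟨u, hu, rfl⟩
    exact φ.map_rel_iff.2 hu

lemma GraphIso.symm {T T' : TreeProduct d} (h : T.GraphIso T') : T'.GraphIso T :=
  h.map RelIso.symm

end TreeProduct

section BushProduct

variable {d : ℕ} (j₀ : Fin d) {X : Type}

lemma bushProduct_tree_self [Finite X] (c : X → Bool) : (bushProduct j₀ c).tree j₀ = bush c :=
  if_pos rfl

lemma bushProduct_tree_ne [Finite X] (c : X → Bool) {j : Fin d} (hj : j ≠ j₀) :
    (bushProduct j₀ c).tree j = pathTree :=
  if_neg hj

lemma ncard_children_bushProduct_ne [Finite X] (c : X → Bool) {j : Fin d} (hj : j ≠ j₀)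
    (x : ((bushProduct j₀ c).tree j).V) :
    (((bushProduct j₀ c).tree j).children x).ncard = 1 := by
  have h : ∀ S : RootedDirectedTree, S = pathTree → ∀ x : S.V, (S.children x).ncard = 1 := by
    rintro _ rfl x
    exact Set.ncard_singleton _
  exact h _ (bushProduct_tree_ne j₀ c hj) x

/-- The factor of `bushProduct` is an `if`; a variable `S` allows the equation to be substituted
without transport of vertices. -/
lemma exists_bushVertOf [Finite X] (c : X → Bool) {S : RootedDirectedTree} (hS : S = bush c) :
    ∃ p : Option X → S.V, (∀ v, (S.children v).ncard = Nat.card {x // p x = v} + 1) ∧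
      ∀ x, S.depth (p x) = bushDepth x := by
  subst hS
  exact ⟨bushVertOf c, ncard_children_bush c, depth_bushVertOf c⟩

/-- The Hilbert module of the product of a tree with branching at the root and at its two children,
and of paths. -/
def bushModule {a : ℕ} (ha : 0 < a) [Fintype X] (c : X → Bool) :
    HilbertModule a (bushProduct j₀ c) :=
  (bushProduct j₀ c).axisModule j₀ ha bushDepth
    (exists_bushVertOf c (bushProduct_tree_self j₀ c)).choose
    (fun v => by
      rw [TreeProduct.card_childFinset]
      exact (exists_bushVertOf c (bushProduct_tree_self j₀ c)).choose_spec.1 v)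
    (fun j hj x => by
      rw [TreeProduct.card_childFinset, ncard_children_bushProduct_ne j₀ c hj])
    (exists_bushVertOf c (bushProduct_tree_self j₀ c)).choose_spec.2

lemma ncard_adj_bushProduct [Finite X] (c : X → Bool) (v : (bushProduct j₀ c).Vert) :
    {w | (bushProduct j₀ c).Adj v w}.ncard =
      (((bushProduct j₀ c).tree j₀).children (v j₀)).ncard + (d - 1) := by
  classical
  rw [TreeProduct.ncard_adj, ← Finset.add_sum_erase _ _ (Finset.mem_univ j₀),
    Finset.sum_congr rfl (g := fun _ => 1) fun j hj =>
      ncard_children_bushProduct_ne j₀ c (Finset.mem_erase.1 hj).1 _]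
  simp

lemma ncard_adj_bushProduct_le [Finite X] (c : X → Bool) {D : ℕ} (h1 : 1 ≤ D)
    (hD : ∀ t, Nat.card {x // c x = t} ≤ D) (v : (bushProduct j₀ c).Vert) :
    {w | (bushProduct j₀ c).Adj v w}.ncard ≤ D + d := by
  have h : ∀ S : RootedDirectedTree, S = bush c → ∀ x : S.V, (S.children x).ncard ≤ D + 1 := by
    rintro _ rfl (_ | t | ⟨t, x, n⟩)
    · exact (ncard_children_root c).trans_le (by omega)
    · exact (ncard_children_mid c t).trans_le (by have := hD t; omega)
    · exact (ncard_children_ray c t x n).trans_le (by omega)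
  rw [ncard_adj_bushProduct]
  have := h _ (bushProduct_tree_self j₀ c) (v j₀)
  have := Fin.pos j₀
  omega

lemma exists_ncard_adj_bushProduct [Finite X] (c : X → Bool) (t : Bool) :
    ∃ v : (bushProduct j₀ c).Vert,
      {w | (bushProduct j₀ c).Adj v w}.ncard = Nat.card {x // c x = t} + d := by
  have h : ∀ S : RootedDirectedTree, S = bush c →
      ∃ x : S.V, (S.children x).ncard = Nat.card {x // c x = t} + 1 := by
    rintro _ rfl
    exact ⟨_, ncard_children_mid c t⟩
  obtain ⟨x, hx⟩ := h _ (bushProduct_tree_self j₀ c)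
  refine ⟨(bushProduct j₀ c).axisVert j₀ x, ?_⟩
  rw [ncard_adj_bushProduct, TreeProduct.axisVert_self, hx]
  have := Fin.pos j₀
  omega

/-- The paths contribute `d - 1` children to every vertex, so for `c` no vertex has more than
`Nat.card {x // c x = true} + d` children, while for `c'` some vertex has. The hypothesis `h2`
covers the root of the bush, which has two children. -/
lemma not_graphIso_bushProduct [Finite X] (c c' : X → Bool)
    (h1 : Nat.card {x // c x = false} ≤ Nat.card {x // c x = true})
    (h2 : 1 ≤ Nat.card {x // c x = true})
    (h : Nat.card {x // c x = true} < Nat.card {x // c' x = true}) :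
    ¬ (bushProduct j₀ c').GraphIso (bushProduct j₀ c) := by
  intro e
  obtain ⟨v, hv⟩ := exists_ncard_adj_bushProduct j₀ c' true
  obtain ⟨v', hv'⟩ := e.exists_ncard_eq v
  have := ncard_adj_bushProduct_le j₀ c h2 (by rintro (_ | _) <;> simp [h1]) v'
  omega

end BushProduct

end DruryArveson
end

/-! ### The two families of examples. -/

open DruryArveson

theorem corollary1p7 (a d : ℕ) (ha : 0 < a) (hd : 0 < d) :
    (∃ (T : ℕ → DruryArveson.TreeProduct d) (X : ∀ n, DruryArveson.HilbertModule a (T n)),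
      ∀ m n, m ≠ n → ¬ (X m).Iso (X n)) ∧
    (∀ k : ℕ, 0 < k →
      ∃ (T : Fin k → DruryArveson.TreeProduct d) (X : ∀ i, DruryArveson.HilbertModule a (T i)),
        (∀ i j, i ≠ j → ¬ (T i).GraphIso (T j)) ∧ ∀ i j, (X i).Iso (X j)) := by
  refine ⟨⟨fun n => bushProduct ⟨0, hd⟩ fun _ : Fin n => true,
    fun n => bushModule ⟨0, hd⟩ ha fun _ : Fin n => true, fun m n hmn h => hmn ?_⟩, fun k hk => ?_⟩
  -- The basis is indexed by `Option (Option (Fin n))`: the point mass at the root, one vector from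
  -- the branching of the root of the bush, and `n` vectors from its child `true`.
  · have e : ∀ n, Module.finrank ℂ (jointCokernel
        (bushModule ⟨0, hd⟩ ha fun _ : Fin n => true).M) = n + 2 := fun n =>
      (finrank_axisModule ha _ _ _ _ _ _).trans (by simp)
    have := h.finrank_jointCokernel_eq
    rw [e, e] at this
    omega
  -- The `2k` extra children are split as `k + i` and `k - i`. The larger share is that of `true`
  -- and grows strictly with `i`, whereas the total and the depths stay fixed.
  · let c : Fin k → Fin (2 * k) → Bool := fun i x => decide ((x : ℕ) < k + i)
    have ht : ∀ i, Nat.card {x // c i x = true} = k + i := fun i => by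
      rw [Nat.card_eq_fintype_card, Fintype.card_subtype]
      simp only [c, decide_eq_true_eq]
      rw [Fin.card_filter_val_lt]
      omega
    have hf : ∀ i, Nat.card {x // c i x = false} ≤ k + i := fun i => by
      have h := Fintype.card_subtype_compl fun x => c i x = true
      simp only [Bool.not_eq_true, ← Nat.card_eq_fintype_card, ht, Nat.card_fin] at h
      omega
    have hlt : ∀ i j : Fin k, i < j →
        ¬ (bushProduct ⟨0, hd⟩ (c j)).GraphIso (bushProduct ⟨0, hd⟩ (c i)) := fun i j hij =>
      not_graphIso_bushProduct _ _ _ (by rw [ht]; exact hf i) (by rw [ht]; omega)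
        (by rw [ht, ht]; omega)
    refine ⟨fun i => bushProduct ⟨0, hd⟩ (c i), fun i => bushModule ⟨0, hd⟩ ha (c i),
      fun i j hij h => ?_, fun i j => iso_axisModule ha _ _ _ _ _ _ _ _ _ _⟩
    rcases lt_or_gt_of_ne hij with h' | h'
    · exact hlt i j h' h.symm
    · exact hlt j i h' h
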